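/- Let $(S_1,\sigma|dz|^2)$ and $(S_2,\rho|dw|^2)$ be connected Riemann surfaces with smooth conformal metrics, each lying as an open subset in a Hausdorff space $\bar S_i$ ($\partial S_i:=\bar S_i\setminus S_i$, possibly empty), and let $h:\partial S_1\to\bar S_2$ be given boundary values. Let $\mathcal A$ be either the set of all smooth diffeomorphisms $g:S_1\to S_2$ such that $g(x)\to h(p)$ in $\bar S_2$ as $x\to p$, $x \in S_1$, for every $p\in\partial S_1$, or the set of those among them that are quasi-conformal (i.e. $|g_{\bar z}|\le k|g_z|$ for some constant $k<1$). Let $\mu\,\frac{d\bar z}{dz}$ be a measurable Beltrami differential on $S_1$ with $\|\mu\|_\infty<1$ whose modulus $|\mu|$ is constant, and let $g(\mu)$ be the metric $\sigma|dz+\mu\,d\bar z|^2$ (it represents the conformal structure $|dz+\mu\,d\bar z|^2$). Let $f=\mathbf{LBS}(\mu)$, that is, $f\in\mathcal A$ minimizes $$E_{LBS}(g)=\int_{S_1}\rho(g(z))\,|g_{\bar z}-\mu g_z|^2\,dx\,dy$$ over all $g\in\mathcal A$, and $E_{LBS}(f)<\infty$. Then $f$ is a harmonic map from $(S_1,g(\mu))$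 to $(S_2,\rho|dw|^2)$: it is a critical point of the harmonic energy $E_{harm}(f)=\int_{S_1}\frac12\|df\|^2\,dv_{g(\mu)}$, i.e. for every smooth family of maps $f_t:S_1\to S_2$ ($t\in\mathbb R$) with $f_0=f$ and $f_t=f$ off a compact set $K\subset S_1$, the energy $\int_K\frac12\|df_t\|^2\,dv_{g(\mu)}$ is finite for all $t$ and its derivative at $t=0$ exists and is $0$. -/

import Mathlib

open scoped Manifold ContDiff Topology
open MeasureTheory

noncomputable section

namespace Surface

/- Throughout, a Riemann surface is a Hausdorff second countable space `S` with a holomorphic atlas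
of complex charts (`ChartedSpace ℂ S`, `IsManifold 𝓘(ℂ) ω S`). Its underlying real smooth surface
is the same charted space with the real model `𝓘(ℝ, ℂ)`. Tensors on `S` are given, as usual, by
their coefficients in the charts of the atlas together with the transformation law on overlaps. -/

section Tensors

variable (S : Type*) [TopologicalSpace S] [ChartedSpace ℂ S]

/-- A (measurable) Riemannian metric on a Riemann surface: in each chart `c` of the atlas, a
symmetric positive definite real bilinear form at each point of the coordinate domain. -/
structure RMetric where
  form : OpenPartialHomeomorph S ℂ → ℂ → LinearMap.BilinForm ℝ ℂ
  symm : ∀ c ∈ atlas ℂ S, ∀ z ∈ c.target, ∀ u v : ℂ, form c z u v = form c z v u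
  pos : ∀ c ∈ atlas ℂ S, ∀ z ∈ c.target, ∀ u : ℂ, u ≠ 0 → 0 < form c z u u
  aemeasurable : ∀ c ∈ atlas ℂ S, ∀ u v : ℂ,
    AEMeasurable (fun z => form c z u v) (volume.restrict c.target)
  transform : ∀ c ∈ atlas ℂ S, ∀ c' ∈ atlas ℂ S, ∀ x ∈ c.source ∩ c'.source, ∀ u v : ℂ,
    form c (c x) u v =
      form c' (c' x) (deriv (c' ∘ c.symm) (c x) * u) (deriv (c' ∘ c.symm) (c x) * v)

/-- A smooth conformal metric `σ |dz|²` on a Riemann surface. -/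
structure ConformalMetric where
  coeff : OpenPartialHomeomorph S ℂ → ℂ → ℝ
  smooth : ∀ c ∈ atlas ℂ S, ContDiffOn ℝ ∞ (coeff c) c.target
  pos : ∀ c ∈ atlas ℂ S, ∀ z ∈ c.target, 0 < coeff c z
  transform : ∀ c ∈ atlas ℂ S, ∀ c' ∈ atlas ℂ S, ∀ x ∈ c.source ∩ c'.source,
    coeff c (c x) = coeff c' (c' x) * ‖deriv (c' ∘ c.symm) (c x)‖ ^ 2

/-- A Beltrami differential `μ dz̄/dz` with `‖μ‖_∞ < 1`. The transformation law says
`μ_c dz̄_c/dz_c = μ_c' dz̄_c'/dz_c'` on overlaps. -/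
structure BeltramiDifferential where
  coeff : OpenPartialHomeomorph S ℂ → ℂ → ℂ
  aemeasurable : ∀ c ∈ atlas ℂ S, AEMeasurable (coeff c) (volume.restrict c.target)
  bound : ∃ k < (1 : ℝ), ∀ c ∈ atlas ℂ S, ∀ z ∈ c.target, ‖coeff c z‖ ≤ k
  transform : ∀ c ∈ atlas ℂ S, ∀ c' ∈ atlas ℂ S, ∀ x ∈ c.source ∩ c'.source,
    coeff c (c x) = coeff c' (c' x) *
      (starRingEnd ℂ (deriv (c' ∘ c.symm) (c x)) / deriv (c' ∘ c.symm) (c x))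

end Tensors

section Measure

variable {S : Type*} [TopologicalSpace S] [ChartedSpace ℂ S]

/-- `det g = g(∂x,∂x) g(∂y,∂y) - g(∂x,∂y)²` at `z` in the coordinate `x + i y` given by the chart `c`. -/
def RMetric.det (g : RMetric S) (c : OpenPartialHomeomorph S ℂ) (z : ℂ) : ℝ :=
  g.form c z 1 1 * g.form c z Complex.I Complex.I - g.form c z 1 Complex.I ^ 2

/-- The Riemannian area measure of `g`. In a chart `c` it is `√(det g) dx dy`. These local measures,
carried to `S` (and zero off the chart domain), agree on overlaps of chart domains, so that their
supremum (the smallest measure that is at least each of them) is the measure obtained by gluing. -/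
def RMetric.area [MeasurableSpace S] (g : RMetric S) : Measure S :=
  ⨆ c ∈ atlas ℂ S, Measure.map c.symm
    ((volume.restrict c.target).withDensity fun z => ENNReal.ofReal (Real.sqrt (g.det c z)))

/-- `μ` has constant modulus. -/
def BeltramiDifferential.HasConstantModulus (μ : BeltramiDifferential S) : Prop :=
  ∃ k : ℝ, ∀ c ∈ atlas ℂ S, ∀ z ∈ c.target, ‖μ.coeff c z‖ = k

/-- The real linear map `u ↦ u + m ū`, i.e. `dz + m dz̄`. -/
def dzeta (m : ℂ) : ℂ →ₗ[ℝ] ℂ :=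
  LinearMap.id + m • (Complex.conjAe.toLinearMap : ℂ →ₗ[ℝ] ℂ)

theorem dzeta_apply (m u : ℂ) : dzeta m u = u + m * starRingEnd ℂ u := by
  simp [dzeta]

theorem dzeta_ne_zero {m u : ℂ} (hm : ‖m‖ < 1) (hu : u ≠ 0) : dzeta m u ≠ 0 := by
  rw [dzeta_apply]
  intro h
  have h1 : u = -(m * starRingEnd ℂ u) := eq_neg_of_add_eq_zero_left h
  have h2 : ‖u‖ = ‖m‖ * ‖u‖ := by
    conv_lhs => rw [h1]
    rw [norm_neg, norm_mul, Complex.norm_conj]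
  have h3 : 0 < ‖u‖ := norm_pos_iff.mpr hu
  nlinarith

theorem dzeta_mul {m T u : ℂ} (hT : T ≠ 0) :
    T * dzeta (m * (starRingEnd ℂ T / T)) u = dzeta m (T * u) := by
  rw [dzeta_apply, dzeta_apply, map_mul]
  field_simp

theorem inner_mul_mul (T u v : ℂ) :
    inner ℝ (T * u) (T * v) = ‖T‖ ^ 2 * inner ℝ u v := by
  simp only [Complex.inner, ← Complex.normSq_eq_norm_sq, Complex.normSq_apply, map_mul,
    Complex.mul_re, Complex.mul_im, Complex.conj_re, Complex.conj_im]
  ring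

/-- The metric `g(μ) = σ |dz + μ dz̄|²`: the Riemannian metric whose conformal class is the conformal
structure `|dz + μ dz̄|²` induced by `μ`. -/
def gMetric (σ : ConformalMetric S) (μ : BeltramiDifferential S) : RMetric S where
  form c z := σ.coeff c z • (innerₗ ℂ).compl₁₂ (dzeta (μ.coeff c z)) (dzeta (μ.coeff c z))
  symm c _ z _ u v := by
    simp [real_inner_comm]
  pos c hc z hz u hu := by
    obtain ⟨k, hk, hb⟩ := μ.bound
    have h := dzeta_ne_zero ((hb c hc z hz).trans_lt hk) hu
    simpa using mul_pos (σ.pos c hc z hz) (pow_pos (norm_pos_iff.mpr h) 2)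
  aemeasurable c hc u v := by
    have h1 : AEMeasurable (σ.coeff c) (volume.restrict c.target) :=
      (σ.smooth c hc).continuousOn.aemeasurable c.open_target.measurableSet
    have h2 := μ.aemeasurable c hc
    simp only [LinearMap.smul_apply, LinearMap.compl₁₂_apply, innerₗ_apply_apply, dzeta_apply,
      smul_eq_mul]
    exact h1.mul (((h2.mul_const _).const_add _).inner ((h2.mul_const _).const_add _))
  transform c hc c' hc' x hx u v := by
    have hT : deriv (c' ∘ c.symm) (c x) ≠ 0 := by
      intro h0
      have h := σ.transform c hc c' hc' x hx
      have hp := σ.pos c hc (c x) (c.map_source hx.1)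
      rw [h0] at h
      simp at h
      exact hp.ne' h
    simp only [LinearMap.smul_apply, LinearMap.compl₁₂_apply, innerₗ_apply_apply, smul_eq_mul]
    rw [← dzeta_mul hT, ← dzeta_mul hT, inner_mul_mul, σ.transform c hc c' hc' x hx,
      μ.transform c hc c' hc' x hx, mul_assoc]

/-- The zero Beltrami differential. -/
def zeroBeltrami : BeltramiDifferential S where
  coeff _ _ := 0
  aemeasurable _ _ := aemeasurable_const
  bound := ⟨0, zero_lt_one, by simp⟩
  transform := by simp

/-- A conformal metric `σ |dz|²` as a Riemannian metric. -/
def ConformalMetric.toRMetric (σ : ConformalMetric S) : RMetric S := gMetric σ zeroBeltrami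

end Measure

section Maps

variable {S₁ : Type*} [TopologicalSpace S₁] [ChartedSpace ℂ S₁]
  {S₂ : Type*} [TopologicalSpace S₂] [ChartedSpace ℂ S₂]

/-- The real derivative at `x` of the coordinate expression `w(z)` of `f`, where `z` is the preferred
chart at `x` and `w` the preferred chart at `f x`. -/
def dmap (f : S₁ → S₂) (x : S₁) : ℂ →L[ℝ] ℂ :=
  fderiv ℝ (chartAt ℂ (f x) ∘ f ∘ (chartAt ℂ x).symm) (chartAt ℂ x x)

/-- `∂f/∂z = (f_x - i f_y) / 2`. -/
def dz (f : S₁ → S₂) (x : S₁) : ℂ := (dmap f x 1 - Complex.I * dmap f x Complex.I) / 2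

/-- `∂f/∂z̄ = (f_x + i f_y) / 2`. -/
def dzbar (f : S₁ → S₂) (x : S₁) : ℂ := (dmap f x 1 + Complex.I * dmap f x Complex.I) / 2

/-- The value at `x` of the coefficient of a conformal metric, in the preferred chart at `x`. -/
def ConformalMetric.at (σ : ConformalMetric S₁) (x : S₁) : ℝ :=
  σ.coeff (chartAt ℂ x) (chartAt ℂ x x)

/-- The value at `x` of the coefficient of a Beltrami differential, in the preferred chart at `x`. -/
def BeltramiDifferential.at (μ : BeltramiDifferential S₁) (x : S₁) : ℂ :=
  μ.coeff (chartAt ℂ x) (chartAt ℂ x x)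

/-- The value at `x` of a Riemannian metric, in the preferred chart at `x`. -/
def RMetric.at (g : RMetric S₁) (x : S₁) : LinearMap.BilinForm ℝ ℂ :=
  g.form (chartAt ℂ x) (chartAt ℂ x x)

/-- `‖df‖² = g^{ij} h_{αβ} ∂_i f^α ∂_j f^β`, the squared norm at `x` of the differential of `f` as a
map from `(S₁, g)` to `(S₂, ρ |dw|²)`; the inverse of the matrix of `g` is written out. -/
def normSqDf (g : RMetric S₁) (ρ : ConformalMetric S₂) (f : S₁ → S₂) (x : S₁) : ℝ :=
  ρ.at (f x) *
    (g.at x Complex.I Complex.I * ‖dmap f x 1‖ ^ 2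
      - 2 * g.at x 1 Complex.I * inner ℝ (dmap f x 1) (dmap f x Complex.I)
      + g.at x 1 1 * ‖dmap f x Complex.I‖ ^ 2) /
    (g.at x 1 1 * g.at x Complex.I Complex.I - g.at x 1 Complex.I ^ 2)

/-- The harmonic energy `∫_K ½ ‖df‖² dv_g` of `f : (S₁, g) → (S₂, ρ |dw|²)` over `K ⊆ S₁`. -/
def harmonicEnergyOn [MeasurableSpace S₁] (g : RMetric S₁) (ρ : ConformalMetric S₂) (K : Set S₁)
    (f : S₁ → S₂) : ENNReal :=
  ∫⁻ x in K, ENNReal.ofReal (1 / 2 * normSqDf g ρ f x) ∂g.area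

/-- `f` is a harmonic map from `(S₁, g)` to `(S₂, ρ |dw|²)`: a smooth critical point of the harmonic
energy. Variations are arbitrary smooth one-parameter families of maps `S₁ → S₂` through `f` that are
fixed off a compact set `K`; as only the energy over `K` varies, it is the energy over `K` that is
differentiated, which makes sense also if the total energy is infinite. -/
structure IsHarmonicMap [MeasurableSpace S₁] (g : RMetric S₁) (ρ : ConformalMetric S₂)
    (f : S₁ → S₂) : Prop where
  smooth : ContMDiff 𝓘(ℝ, ℂ) 𝓘(ℝ, ℂ) ∞ f
  critical : ∀ (K : Set S₁) (F : ℝ → S₁ → S₂), IsCompact K →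
    ContMDiff (𝓘(ℝ, ℝ).prod 𝓘(ℝ, ℂ)) 𝓘(ℝ, ℂ) ∞ (fun p : ℝ × S₁ => F p.1 p.2) →
    F 0 = f → (∀ t, ∀ x ∉ K, F t x = f x) →
    (∀ t, harmonicEnergyOn g ρ K (F t) ≠ ⊤) ∧
      HasDerivAt (fun t => (harmonicEnergyOn g ρ K (F t)).toReal) 0 0

/-- The least squares Beltrami energy `∫_{S₁} |∂f/∂z̄ - μ ∂f/∂z|² dS₁`. Here `dS₁` is the area element
of `σ |dz|²` and the modulus is that given by `σ |dz|²` and `ρ |dw|²`, so that the integral is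
`∫ ρ(f(z)) |f_z̄ - μ f_z|² dx dy` in coordinates. -/
def lbsEnergy [MeasurableSpace S₁] (σ : ConformalMetric S₁) (ρ : ConformalMetric S₂)
    (μ : BeltramiDifferential S₁) (f : S₁ → S₂) : ENNReal :=
  ∫⁻ x, ENNReal.ofReal (ρ.at (f x) / σ.at x * ‖dzbar f x - μ.at x * dz f x‖ ^ 2) ∂σ.toRMetric.area

variable (S₁ S₂) in
/-- Smooth diffeomorphisms from `S₁` onto `S₂` (no condition on the orientation). -/
abbrev Diffeo := Diffeomorph 𝓘(ℝ, ℂ) 𝓘(ℝ, ℂ) S₁ S₂ ∞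

/-- `f` is quasi-conformal: `|f_z̄| ≤ k |f_z|` for some `k < 1`. For a diffeomorphism this includes
that the orientation is preserved. -/
def IsQuasiconformal (f : S₁ → S₂) : Prop :=
  ∃ k < (1 : ℝ), ∀ x, ‖dzbar f x‖ ≤ k * ‖dz f x‖

/-- The diffeomorphisms with boundary values `h`. The surface `Sᵢ` lies in a larger space `Sᵢ'` by
`jᵢ`, and its boundary consists of the points of `Sᵢ'` outside of `Sᵢ`. If `Sᵢ' = Sᵢ`, there is no
boundary, and these are all diffeomorphisms. -/
def boundaryClass {S₁' : Type*} [TopologicalSpace S₁'] {S₂' : Type*} [TopologicalSpace S₂']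
    (j₁ : S₁ → S₁') (j₂ : S₂ → S₂') (h : S₁' → S₂') : Set (Diffeo S₁ S₂) :=
  {f | ∀ p ∉ Set.range j₁, Filter.Tendsto (j₂ ∘ f) (Filter.comap j₁ (𝓝 p)) (𝓝 (h p))}

/-- `f = LBS(μ)`: `f` minimizes the (finite) least squares Beltrami energy over the class `𝒜`. -/
structure IsLBS [MeasurableSpace S₁] (σ : ConformalMetric S₁) (ρ : ConformalMetric S₂)
    (μ : BeltramiDifferential S₁) (𝒜 : Set (Diffeo S₁ S₂)) (f : Diffeo S₁ S₂) : Prop where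
  mem : f ∈ 𝒜
  finite : lbsEnergy σ ρ μ f ≠ ⊤
  minimal : ∀ g ∈ 𝒜, lbsEnergy σ ρ μ f ≤ lbsEnergy σ ρ μ g

end Maps

end Surface

end

/-! Write `dζ = dz + μ dz̄`. Solving `df = f_ζ dζ + f_ζ̄ dζ̄` gives `f_ζ̄ = (f_z̄ - μ f_z)/(1 -
|μ|²)` and `f_ζ = (f_z - μ̄ f_z̄)/(1 - |μ|²)`, and the harmonic energy density for `σ|dζ|²` is
`ρ(|f_ζ|² + |f_ζ̄|²)/σ`. The two numerators have the same cross term, so `|f_z - μ̄ f_z̄|²` equals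
`|f_z̄ - μ f_z|²` plus `(1 - |μ|²)` times the Jacobian. With respect to the area of `σ|dz|²`,
harmonic energy is therefore `2/(1 - k²)` times Beltrami energy plus the integral of the signed
Jacobian weighted by `ρ(f)` (`normSqDf_eq_lbs_add`). The constancy of `|μ| = k` is what allows the
factor `2/(1 - k²)` to leave the integral.

Up to sign, the Jacobian term over `K` is the `ρ`-area of `f(K)` (`setLIntegral_jacDensity`). A
diffeomorphism that agrees with `f` off `K` has the same image of `K`, so this term does not change.
The sign is constant, because `S₁` is connected, and it persists for small variations; both signs
are admitted.

It remains to see that minimality may be tested on the variation. For small `t` the map `F t` is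
again a diffeomorphism (`eventually_exists_diffeo`) with the same boundary values, and
quasi-conformal if `f` is. Hence `t = 0` is a local minimum of the harmonic energy over `K`. That
energy is finite and differentiable in `t` (`harmonicEnergyOn_family`), so its derivative vanishes
there. Differentiability survives a merely measurable `μ`: in charts the density is `P + Re (μ Q)`,
where `P` and `Q` are smooth in `(t, z)` and `μ` does not depend on `t`. -/

namespace Surface

/-! ### Algebra of real linear maps of the complex plane -/

/-- The complex linear part `L_z` of a real linear map `L u = L_z u + L_z̄ ū`. -/
noncomputable def linPart (L : ℂ →L[ℝ] ℂ) : ℂ := (L 1 - Complex.I * L Complex.I) / 2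

/-- The antilinear part `L_z̄` of a real linear map `L u = L_z u + L_z̄ ū`. -/
noncomputable def antiPart (L : ℂ →L[ℝ] ℂ) : ℂ := (L 1 + Complex.I * L Complex.I) / 2

/-- Multiplication by a complex number as a real linear map. -/
noncomputable def mulCLM (a : ℂ) : ℂ →L[ℝ] ℂ := ContinuousLinearMap.mul ℝ ℂ a

@[simp] theorem mulCLM_apply (a u : ℂ) : mulCLM a u = a * u := rfl

theorem apply_eq_parts (L : ℂ →L[ℝ] ℂ) (u : ℂ) :
    L u = linPart L * u + antiPart L * starRingEnd ℂ u := by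
  have h : L u = u.re * L 1 + u.im * L Complex.I := by
    conv_lhs => rw [show u = u.re • (1 : ℂ) + u.im • Complex.I by simp]
    rw [map_add, L.map_smul, L.map_smul, Complex.real_smul, Complex.real_smul]
  rw [h]
  simp only [linPart, antiPart]
  have h2 : starRingEnd ℂ u = u.re - u.im * Complex.I := by
    apply Complex.ext <;> simp
  rw [h2]
  conv_rhs => rw [show u = u.re + u.im * Complex.I by simp]
  simp only [Complex.add_re, Complex.ofReal_re, Complex.mul_re, Complex.add_im, Complex.I_re, Complex.I_im,
    Complex.ofReal_im, Complex.mul_im, mul_zero, mul_one, sub_zero, add_zero, zero_add]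
  linear_combination ((u.im : ℂ) * L Complex.I) * Complex.I_sq

/-- With `antiPart_comp`, this is the transformation law of `f_z` and `f_z̄` under holomorphic
changes of both charts: the two norms are scaled by the same factor. -/
theorem linPart_comp (a b : ℂ) (L : ℂ →L[ℝ] ℂ) :
    linPart (mulCLM a ∘L L ∘L mulCLM b) = a * b * linPart L := by
  simp only [linPart, ContinuousLinearMap.comp_apply, mulCLM_apply]
  rw [apply_eq_parts L (b * 1), apply_eq_parts L (b * Complex.I)]
  simp only [linPart, antiPart, map_mul, Complex.conj_I, mul_one]
  linear_combination (-a * b * (L 1 - Complex.I * L Complex.I) / 4 + a * (starRingEnd ℂ b) * (L 1 + Complex.I * L Complex.I) / 4) * Complex.I_sq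

theorem antiPart_comp (a b : ℂ) (L : ℂ →L[ℝ] ℂ) :
    antiPart (mulCLM a ∘L L ∘L mulCLM b) = a * starRingEnd ℂ b * antiPart L := by
  simp only [antiPart, ContinuousLinearMap.comp_apply, mulCLM_apply]
  rw [apply_eq_parts L (b * 1), apply_eq_parts L (b * Complex.I)]
  simp only [linPart, antiPart, map_mul, Complex.conj_I, mul_one]
  linear_combination (a * b * (L 1 - Complex.I * L Complex.I) / 4 - a * (starRingEnd ℂ b) * (L 1 + Complex.I * L Complex.I) / 4) * Complex.I_sq

theorem det_eq_parts (L : ℂ →L[ℝ] ℂ) :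
    L.det = ‖linPart L‖ ^ 2 - ‖antiPart L‖ ^ 2 := by
  have h : L.det = (L 1).re * (L Complex.I).im - (L Complex.I).re * (L 1).im := by
    rw [ContinuousLinearMap.det, ← LinearMap.det_toMatrix Complex.basisOneI, Matrix.det_fin_two]
    simp [LinearMap.toMatrix_apply]
  rw [h, ← Complex.normSq_eq_norm_sq, ← Complex.normSq_eq_norm_sq]
  simp [linPart, antiPart, Complex.normSq_apply]
  ring

/-- Both squares have cross term `-2 Re (m B Ā)`. For `A = f_z̄`, `B = f_z`, `m = μ` the difference
left over is a multiple of the Jacobian. -/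
theorem normSq_parts_identity (m A B : ℂ) :
    ‖B - starRingEnd ℂ m * A‖ ^ 2 = ‖A - m * B‖ ^ 2 + (1 - ‖m‖ ^ 2) * (‖B‖ ^ 2 - ‖A‖ ^ 2) := by
  simp only [← Complex.normSq_eq_norm_sq, Complex.normSq_apply, Complex.sub_re, Complex.sub_im,
    Complex.mul_re, Complex.mul_im, Complex.conj_re, Complex.conj_im]
  ring

/-- Apart from its modulus, `m` enters the energy density only linearly; this is the source of the
form `P + Re (μ Q)`. -/
theorem normSq_parts_expand (m A B : ℂ) :
    ‖A - m * B‖ ^ 2 + ‖B - starRingEnd ℂ m * A‖ ^ 2 =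
      (1 + ‖m‖ ^ 2) * (‖A‖ ^ 2 + ‖B‖ ^ 2) - 4 * (m * (B * starRingEnd ℂ A)).re := by
  simp only [← Complex.normSq_eq_norm_sq, Complex.normSq_apply, Complex.sub_re, Complex.sub_im,
    Complex.mul_re, Complex.mul_im, Complex.conj_re, Complex.conj_im]
  ring

/-! ### The metric `σ|dz + μ dz̄|²` in coordinates -/

section

variable {S : Type*} [TopologicalSpace S] [ChartedSpace ℂ S]

theorem gMetric_form_apply (σ : ConformalMetric S) (μ : BeltramiDifferential S)
    (c : OpenPartialHomeomorph S ℂ) (z u v : ℂ) :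
    (gMetric σ μ).form c z u v =
      σ.coeff c z * inner ℝ (dzeta (μ.coeff c z) u) (dzeta (μ.coeff c z) v) := by
  simp [gMetric]

theorem gMetric_det (σ : ConformalMetric S) (μ : BeltramiDifferential S)
    (c : OpenPartialHomeomorph S ℂ) (z : ℂ) :
    (gMetric σ μ).det c z = (σ.coeff c z * (1 - ‖μ.coeff c z‖ ^ 2)) ^ 2 := by
  simp only [RMetric.det, gMetric_form_apply, dzeta_apply, ← Complex.normSq_eq_norm_sq,
    Complex.normSq_apply, Complex.inner, Complex.add_re, Complex.add_im, Complex.mul_re,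
    Complex.mul_im, Complex.conj_re, Complex.conj_im, Complex.I_re, Complex.I_im, Complex.one_re,
    Complex.one_im, map_add, map_mul]
  ring

/-- The two squares are the numerators of `f_ζ̄` and `f_ζ` in the coframe `dζ = dz + μ dz̄`, each
with denominator `1 - |μ|²`. -/
theorem normSqDf_eq {S₂ : Type*} [TopologicalSpace S₂] [ChartedSpace ℂ S₂]
    (σ : ConformalMetric S) (μ : BeltramiDifferential S) (ρ : ConformalMetric S₂) (f : S → S₂) (x : S) :
    normSqDf (gMetric σ μ) ρ f x = 2 * ρ.at (f x) * (‖dzbar f x - μ.at x * dz f x‖ ^ 2 +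
      ‖dz f x - starRingEnd ℂ (μ.at x) * dzbar f x‖ ^ 2) / (σ.at x * (1 - ‖μ.at x‖ ^ 2) ^ 2) := by
  have hdet := gMetric_det σ μ (chartAt ℂ x) (chartAt ℂ x x)
  have hσ : 0 < σ.at x := σ.pos _ (chart_mem_atlas ℂ x) _ (mem_chart_target ℂ x)
  have hμ : ‖μ.at x‖ < 1 := by
    obtain ⟨k, hk, hb⟩ := μ.bound
    exact (hb _ (chart_mem_atlas ℂ x) _ (mem_chart_target ℂ x)).trans_lt hk
  have hμ2 : 0 < 1 - ‖μ.at x‖ ^ 2 := by nlinarith [norm_nonneg (μ.at x)]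
  have hd : (gMetric σ μ).at x 1 1 * (gMetric σ μ).at x Complex.I Complex.I -
      (gMetric σ μ).at x 1 Complex.I ^ 2 = (σ.at x * (1 - ‖μ.at x‖ ^ 2)) ^ 2 := hdet
  rw [normSqDf, hd, div_eq_div_iff (by positivity) (by positivity)]
  have hf : ∀ u v, (gMetric σ μ).at x u v = σ.at x * inner ℝ (dzeta (μ.at x) u) (dzeta (μ.at x) v) :=
    gMetric_form_apply σ μ (chartAt ℂ x) (chartAt ℂ x x)
  have key : (gMetric σ μ).at x Complex.I Complex.I * ‖dmap f x 1‖ ^ 2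
      - 2 * (gMetric σ μ).at x 1 Complex.I * inner ℝ (dmap f x 1) (dmap f x Complex.I)
      + (gMetric σ μ).at x 1 1 * ‖dmap f x Complex.I‖ ^ 2 =
      2 * σ.at x * (‖dzbar f x - μ.at x * dz f x‖ ^ 2 +
      ‖dz f x - starRingEnd ℂ (μ.at x) * dzbar f x‖ ^ 2) := by
    rw [normSq_parts_expand]
    have h1 : dmap f x 1 = dz f x + dzbar f x := by
      rw [apply_eq_parts (dmap f x) 1, map_one, mul_one, mul_one]; rfl
    have h2 : dmap f x Complex.I = (dz f x - dzbar f x) * Complex.I := by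
      rw [apply_eq_parts (dmap f x) Complex.I, Complex.conj_I]
      change dz f x * Complex.I + dzbar f x * -Complex.I = _
      ring
    simp only [hf, h1, h2]
    generalize dz f x = p
    generalize dzbar f x = q
    generalize μ.at x = m
    simp only [dzeta_apply, ← Complex.normSq_eq_norm_sq, Complex.normSq_apply, Complex.inner,
      Complex.add_re, Complex.add_im, Complex.sub_re, Complex.sub_im, Complex.mul_re, Complex.mul_im,
      Complex.conj_re, Complex.conj_im, Complex.I_re, Complex.I_im, Complex.one_re, Complex.one_im,
      map_add, map_mul]
    ring
  rw [key]
  ring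

end

/-! ### Real smooth structure and holomorphic chart changes -/

theorem isManifold_real (S : Type*) [TopologicalSpace S] [ChartedSpace ℂ S]
    [IsManifold 𝓘(ℂ) ω S] : IsManifold 𝓘(ℝ, ℂ) ∞ S := by
  apply isManifold_of_contDiffOn
  intro e e' he he'
  have h := contDiffGroupoid_le (I := 𝓘(ℂ)) (m := ω) (n := ω) le_rfl
    (HasGroupoid.compatible (G := contDiffGroupoid ω 𝓘(ℂ)) he he')
  have h2 := (mem_groupoid_of_pregroupoid.1 h).1
  have h3 : ContDiffOn ℂ ω (e.symm ≫ₕ e') (e.symm ≫ₕ e').source := by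
    simpa [contDiffPregroupoid] using h2
  have h4 : ContDiffOn ℝ ∞ (e.symm ≫ₕ e') (e.symm ≫ₕ e').source :=
    (h3.restrict_scalars ℝ).of_le le_top
  simpa using h4

section

variable {S : Type*} [TopologicalSpace S] [ChartedSpace ℂ S]

theorem hasDerivAt_transition [IsManifold 𝓘(ℂ) ω S] {c c' : OpenPartialHomeomorph S ℂ}
    (hc : c ∈ atlas ℂ S) (hc' : c' ∈ atlas ℂ S) {x : S} (hx : x ∈ c.source) (hx' : x ∈ c'.source) :
    HasDerivAt (c' ∘ c.symm) (deriv (c' ∘ c.symm) (c x)) (c x) := by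
  have h := HasGroupoid.compatible (G := contDiffGroupoid ω 𝓘(ℂ)) hc hc'
  have h2 := (mem_groupoid_of_pregroupoid.1 h).1
  have h3 : ContDiffOn ℂ ω (c.symm ≫ₕ c') (c.symm ≫ₕ c').source := by
    simpa [contDiffPregroupoid] using h2
  have hm : c x ∈ (c.symm ≫ₕ c').source := by
    simp [hx, hx', c.map_source hx]
  have h4 := (h3.contDiffAt ((c.symm ≫ₕ c').open_source.mem_nhds hm)).differentiableAt (by simp)
  exact h4.hasDerivAt

theorem hasFDerivAt_transition [IsManifold 𝓘(ℂ) ω S] {c c' : OpenPartialHomeomorph S ℂ}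
    (hc : c ∈ atlas ℂ S) (hc' : c' ∈ atlas ℂ S) {x : S} (hx : x ∈ c.source) (hx' : x ∈ c'.source) :
    HasFDerivAt (c' ∘ c.symm) (mulCLM (deriv (c' ∘ c.symm) (c x))) (c x) := by
  convert (hasDerivAt_transition hc hc' hx hx').complexToReal_fderiv using 1
  ext
  simp

/-- A zero would make the positive coefficient of `σ` vanish by its transformation law. -/
theorem ConformalMetric.deriv_transition_ne_zero (σ : ConformalMetric S)
    {c c' : OpenPartialHomeomorph S ℂ}
    (hc : c ∈ atlas ℂ S) (hc' : c' ∈ atlas ℂ S) {x : S} (hx : x ∈ c.source) (hx' : x ∈ c'.source) :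
    deriv (c' ∘ c.symm) (c x) ≠ 0 := by
  intro h0
  have h := σ.transform c hc c' hc' x ⟨hx, hx'⟩
  have hp := σ.pos c hc (c x) (c.map_source hx)
  rw [h0] at h
  simp at h
  exact hp.ne' h

end

/-! ### Coordinate expressions of maps and of one-parameter families -/

section

variable {S₁ : Type*} [TopologicalSpace S₁] [ChartedSpace ℂ S₁]
  {S₂ : Type*} [TopologicalSpace S₂] [ChartedSpace ℂ S₂]

/-- The real derivative at `x` of the coordinate expression of `f` in the charts `c` and `c'`. -/
noncomputable def chartDeriv (c : OpenPartialHomeomorph S₁ ℂ) (c' : OpenPartialHomeomorph S₂ ℂ)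
    (f : S₁ → S₂) (x : S₁) : ℂ →L[ℝ] ℂ :=
  fderiv ℝ (c' ∘ f ∘ c.symm) (c x)

theorem differentiableAt_chart [IsManifold 𝓘(ℂ) ω S₁] [IsManifold 𝓘(ℂ) ω S₂]
    {c : OpenPartialHomeomorph S₁ ℂ} {c' : OpenPartialHomeomorph S₂ ℂ}
    (hc : c ∈ atlas ℂ S₁) (hc' : c' ∈ atlas ℂ S₂)
    {f : S₁ → S₂} {x : S₁} (hf : ContMDiffAt 𝓘(ℝ, ℂ) 𝓘(ℝ, ℂ) ∞ f x)
    (hx : x ∈ c.source) (hx' : f x ∈ c'.source) :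
    ContDiffAt ℝ ∞ (c' ∘ f ∘ c.symm) (c x) := by
  have := isManifold_real S₁
  have := isManifold_real S₂
  have h1 := contMDiffOn_symm_of_mem_maximalAtlas (IsManifold.subset_maximalAtlas (I := 𝓘(ℝ, ℂ)) (n := ∞) hc)
  have h2 := contMDiffOn_of_mem_maximalAtlas (IsManifold.subset_maximalAtlas (I := 𝓘(ℝ, ℂ)) (n := ∞) hc')
  have h1' := h1.contMDiffAt (c.open_target.mem_nhds (c.map_source hx))
  have h2' := h2.contMDiffAt (c'.open_source.mem_nhds hx')
  rw [← contMDiffAt_iff_contDiffAt]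
  have e : c.symm (c x) = x := c.left_inv hx
  refine ContMDiffAt.comp (I' := 𝓘(ℝ, ℂ)) (c x) (g := c') ?_ (ContMDiffAt.comp (I' := 𝓘(ℝ, ℂ)) (c x) (g := f) ?_ h1')
  · simpa [e] using h2'
  · simpa [e] using hf

theorem chartDeriv_change [IsManifold 𝓘(ℂ) ω S₁] [IsManifold 𝓘(ℂ) ω S₂]
    {c d : OpenPartialHomeomorph S₁ ℂ} {c' d' : OpenPartialHomeomorph S₂ ℂ}
    (hc : c ∈ atlas ℂ S₁) (hd : d ∈ atlas ℂ S₁) (hc' : c' ∈ atlas ℂ S₂) (hd' : d' ∈ atlas ℂ S₂)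
    {f : S₁ → S₂} {x : S₁} (hf : ContMDiffAt 𝓘(ℝ, ℂ) 𝓘(ℝ, ℂ) ∞ f x)
    (hxc : x ∈ c.source) (hxd : x ∈ d.source) (hxc' : f x ∈ c'.source) (hxd' : f x ∈ d'.source) :
    chartDeriv c c' f x = mulCLM (deriv (c' ∘ d'.symm) (d' (f x))) ∘L chartDeriv d d' f x ∘L
      mulCLM (deriv (d ∘ c.symm) (c x)) := by
  have e : c.symm (c x) = x := c.left_inv hxc
  have e1 : d.symm (d x) = x := d.left_inv hxd
  have hD := ((differentiableAt_chart hd hd' hf hxd hxd').differentiableAt (by simp)).hasFDerivAt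
  have hT1 := hasFDerivAt_transition hc hd hxc hxd
  have hT2 := hasFDerivAt_transition hd' hc' hxd' hxc'
  have hcomp : HasFDerivAt ((c' ∘ d'.symm) ∘ (d' ∘ f ∘ d.symm) ∘ (d ∘ c.symm))
      (mulCLM (deriv (c' ∘ d'.symm) (d' (f x))) ∘L chartDeriv d d' f x ∘L
      mulCLM (deriv (d ∘ c.symm) (c x))) (c x) := by
    refine HasFDerivAt.comp (c x) ?_ (HasFDerivAt.comp (c x) ?_ hT1)
    · simpa [e, e1] using hT2
    · simpa [e, chartDeriv] using hD
  refine HasFDerivAt.fderiv (hcomp.congr_of_eventuallyEq ?_)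
  have hcs : ContinuousAt c.symm (c x) := c.continuousAt_symm (c.map_source hxc)
  have n1 : ∀ᶠ z in 𝓝 (c x), c.symm z ∈ d.source :=
    hcs.eventually_mem (d.open_source.mem_nhds (by rwa [e]))
  have n2 : ∀ᶠ z in 𝓝 (c x), f (c.symm z) ∈ d'.source := by
    have : ContinuousAt (f ∘ c.symm) (c x) :=
      ContinuousAt.comp (by rw [e]; exact hf.continuousAt) hcs
    exact this.eventually_mem (d'.open_source.mem_nhds (by simpa [e] using hxd'))
  filter_upwards [n1, n2] with z h1 h2
  simp [d.left_inv h1, d'.left_inv h2]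

/-- The coordinate expression of a one-parameter family of maps. -/
noncomputable def familyRep (c : OpenPartialHomeomorph S₁ ℂ) (c' : OpenPartialHomeomorph S₂ ℂ)
    (F : ℝ → S₁ → S₂) (p : ℝ × ℂ) : ℂ := c' (F p.1 (c.symm p.2))

/-- The domain of the coordinate expression of a one-parameter family of maps. -/
def familyDomain (c : OpenPartialHomeomorph S₁ ℂ) (c' : OpenPartialHomeomorph S₂ ℂ)
    (F : ℝ → S₁ → S₂) : Set (ℝ × ℂ) := {p | p.2 ∈ c.target ∧ F p.1 (c.symm p.2) ∈ c'.source}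

/-- The derivative in the space variable of the coordinate expression of a family of maps. -/
noncomputable def familyDeriv (c : OpenPartialHomeomorph S₁ ℂ) (c' : OpenPartialHomeomorph S₂ ℂ)
    (F : ℝ → S₁ → S₂) (p : ℝ × ℂ) : ℂ →L[ℝ] ℂ :=
  fderiv ℝ (familyRep c c' F) p ∘L ContinuousLinearMap.inr ℝ ℝ ℂ

section family

variable {c : OpenPartialHomeomorph S₁ ℂ} {c' : OpenPartialHomeomorph S₂ ℂ} {F : ℝ → S₁ → S₂}

theorem isOpen_familyDomain (hF : Continuous (fun p : ℝ × S₁ => F p.1 p.2)) :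
    IsOpen (familyDomain c c' F) := by
  have h : familyDomain c c' F = (Set.univ ×ˢ c.target) ∩
      (fun p : ℝ × ℂ => F p.1 (c.symm p.2)) ⁻¹' c'.source := by
    ext p; simp [familyDomain]
  rw [h]
  refine ContinuousOn.isOpen_inter_preimage ?_ (isOpen_univ.prod c.open_target) c'.open_source
  refine hF.comp_continuousOn (continuousOn_fst.prodMk (c.continuousOn_symm.comp continuousOn_snd ?_))
  intro p hp
  exact hp.2

theorem mem_familyDomain {t : ℝ} {x : S₁} (hx : x ∈ c.source) (hx' : F t x ∈ c'.source) :
    (t, c x) ∈ familyDomain c c' F :=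
  ⟨c.map_source hx, by simpa [c.left_inv hx] using hx'⟩

theorem contMDiff_slice
    (hF : ContMDiff (𝓘(ℝ, ℝ).prod 𝓘(ℝ, ℂ)) 𝓘(ℝ, ℂ) ∞ (fun p : ℝ × S₁ => F p.1 p.2)) (t : ℝ) :
    ContMDiff 𝓘(ℝ, ℂ) 𝓘(ℝ, ℂ) ∞ (F t) :=
  hF.comp (contMDiff_const.prodMk contMDiff_id)

variable [IsManifold 𝓘(ℂ) ω S₁] [IsManifold 𝓘(ℂ) ω S₂]

theorem contDiffOn_familyRep (hc : c ∈ atlas ℂ S₁) (hc' : c' ∈ atlas ℂ S₂)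
    (hF : ContMDiff (𝓘(ℝ, ℝ).prod 𝓘(ℝ, ℂ)) 𝓘(ℝ, ℂ) ∞ (fun p : ℝ × S₁ => F p.1 p.2)) :
    ContDiffOn ℝ ∞ (familyRep c c' F) (familyDomain c c' F) := by
  have := isManifold_real S₁
  have := isManifold_real S₂
  have h1 := contMDiffOn_symm_of_mem_maximalAtlas (IsManifold.subset_maximalAtlas (I := 𝓘(ℝ, ℂ)) (n := ∞) hc)
  have h2 := contMDiffOn_of_mem_maximalAtlas (IsManifold.subset_maximalAtlas (I := 𝓘(ℝ, ℂ)) (n := ∞) hc')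
  rw [← contMDiffOn_iff_contDiffOn]
  refine h2.comp (hF.comp_contMDiffOn (ContMDiffOn.prodMk contDiff_fst.contMDiff.contMDiffOn
    (h1.comp contDiff_snd.contMDiff.contMDiffOn ?_))) ?_
  · intro p hp; exact hp.1
  · intro p hp; exact hp.2

theorem contDiffOn_familyDeriv (hc : c ∈ atlas ℂ S₁) (hc' : c' ∈ atlas ℂ S₂)
    (hF : ContMDiff (𝓘(ℝ, ℝ).prod 𝓘(ℝ, ℂ)) 𝓘(ℝ, ℂ) ∞ (fun p : ℝ × S₁ => F p.1 p.2)) :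
    ContDiffOn ℝ ∞ (familyDeriv c c' F) (familyDomain c c' F) := by
  have h := (contDiffOn_familyRep hc hc' hF).fderiv_of_isOpen (m := ∞)
    (isOpen_familyDomain hF.continuous) (by simp)
  exact h.clm_comp contDiffOn_const

theorem hasStrictFDerivAt_familyRep (hc : c ∈ atlas ℂ S₁) (hc' : c' ∈ atlas ℂ S₂)
    (hF : ContMDiff (𝓘(ℝ, ℝ).prod 𝓘(ℝ, ℂ)) 𝓘(ℝ, ℂ) ∞ (fun p : ℝ × S₁ => F p.1 p.2))
    {p : ℝ × ℂ} (hp : p ∈ familyDomain c c' F) :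
    HasStrictFDerivAt (familyRep c c' F) (fderiv ℝ (familyRep c c' F) p) p :=
  ((contDiffOn_familyRep hc hc' hF).contDiffAt
    ((isOpen_familyDomain hF.continuous).mem_nhds hp)).hasStrictFDerivAt (by simp)

/-- Restricting the joint derivative to the space direction shows that spatial derivatives of the
slices depend smoothly on time and position together. -/
theorem chartDeriv_eq_familyDeriv (hc : c ∈ atlas ℂ S₁) (hc' : c' ∈ atlas ℂ S₂)
    (hF : ContMDiff (𝓘(ℝ, ℝ).prod 𝓘(ℝ, ℂ)) 𝓘(ℝ, ℂ) ∞ (fun p : ℝ × S₁ => F p.1 p.2))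
    {t : ℝ} {x : S₁} (hx : x ∈ c.source) (hx' : F t x ∈ c'.source) :
    chartDeriv c c' (F t) x = familyDeriv c c' F (t, c x) := by
  have h := (hasStrictFDerivAt_familyRep hc hc' hF (mem_familyDomain hx hx')).hasFDerivAt
  exact (h.comp (c x) (hasFDerivAt_prodMk_right t (c x))).fderiv

theorem continuousAt_chartDeriv (hc : c ∈ atlas ℂ S₁) (hc' : c' ∈ atlas ℂ S₂)
    (hF : ContMDiff (𝓘(ℝ, ℝ).prod 𝓘(ℝ, ℂ)) 𝓘(ℝ, ℂ) ∞ (fun p : ℝ × S₁ => F p.1 p.2))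
    {t : ℝ} {x : S₁} (hx : x ∈ c.source) (hx' : F t x ∈ c'.source) :
    ContinuousAt (fun p : ℝ × S₁ => chartDeriv c c' (F p.1) p.2) (t, x) := by
  have h1 : ContinuousAt (familyDeriv c c' F) (t, c x) :=
    (contDiffOn_familyDeriv hc hc' hF).continuousOn.continuousAt
      ((isOpen_familyDomain hF.continuous).mem_nhds (mem_familyDomain hx hx'))
  have h2 : ContinuousAt (fun p : ℝ × S₁ => (p.1, c p.2)) (t, x) :=
    continuousAt_fst.prodMk (ContinuousAt.comp (f := Prod.snd) (g := c) (c.continuousAt hx) continuousAt_snd)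
  have h3 : ContinuousAt (fun p : ℝ × S₁ => familyDeriv c c' F (p.1, c p.2)) (t, x) :=
    ContinuousAt.comp (f := fun p : ℝ × S₁ => (p.1, c p.2)) (g := familyDeriv c c' F) h1 h2
  refine h3.congr ?_
  have n1 : ∀ᶠ p : ℝ × S₁ in 𝓝 (t, x), p.2 ∈ c.source :=
    continuousAt_snd.eventually_mem (c.open_source.mem_nhds hx)
  have n2 : ∀ᶠ p : ℝ × S₁ in 𝓝 (t, x), F p.1 p.2 ∈ c'.source :=
    hF.continuous.continuousAt.eventually_mem (c'.open_source.mem_nhds hx')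
  filter_upwards [n1, n2] with p h1 h2
  exact (chartDeriv_eq_familyDeriv hc hc' hF h1 h2).symm

end family

end

/-! ### Area measures and their gluing -/

theorem exists_countable_iUnion_nhds {S : Type*} [TopologicalSpace S] [SecondCountableTopology S] (U : S → Set S)
    (hU : ∀ x, U x ∈ 𝓝 x) : ∃ s : Set S, s.Countable ∧ ⋃ x : s, U x = Set.univ := by
  obtain ⟨s, hs, hcov⟩ := TopologicalSpace.countable_cover_nhds hU
  exact ⟨s, hs, by rw [← hcov, Set.biUnion_eq_iUnion]⟩

theorem measurableSet_chart_preimage {S : Type*} [TopologicalSpace S] [MeasurableSpace S] [BorelSpace S]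
    (c : OpenPartialHomeomorph S ℂ) {A : Set S} (hA : MeasurableSet A) :
    MeasurableSet (c.target ∩ c.symm ⁻¹' A) := by
  have h : Measurable (c.target.domRestrict c.symm) :=
    (continuousOn_iff_continuous_domRestrict.1 c.continuousOn_symm).measurable
  have h2 := (MeasurableEmbedding.subtype_coe c.open_target.measurableSet).measurableSet_image' (h hA)
  convert h2 using 1
  ext z
  simp [and_comm]

theorem aemeasurable_chart_symm {S : Type*} [TopologicalSpace S] [MeasurableSpace S] [BorelSpace S]
    (c : OpenPartialHomeomorph S ℂ) (w : ℂ → ENNReal) :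
    AEMeasurable c.symm ((volume.restrict c.target).withDensity w) :=
  (c.continuousOn_symm.aemeasurable c.open_target.measurableSet).mono_ac
    (withDensity_absolutelyContinuous _ _)

section

variable {S : Type*} [TopologicalSpace S] [ChartedSpace ℂ S]

/-- The area measure of a conformal metric in a chart, carried to the surface. -/
noncomputable def ConformalMetric.localArea [MeasurableSpace S] (σ : ConformalMetric S)
    (c : OpenPartialHomeomorph S ℂ) : Measure S :=
  Measure.map c.symm ((volume.restrict c.target).withDensity fun z => ENNReal.ofReal (σ.coeff c z))

theorem ConformalMetric.aemeasurable_coeff (σ : ConformalMetric S)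
    {c : OpenPartialHomeomorph S ℂ} (hc : c ∈ atlas ℂ S) :
    AEMeasurable (fun z => ENNReal.ofReal (σ.coeff c z)) (volume.restrict c.target) :=
  ((σ.smooth c hc).continuousOn.aemeasurable c.open_target.measurableSet).ennreal_ofReal

theorem ConformalMetric.localArea_apply [MeasurableSpace S] [BorelSpace S] (σ : ConformalMetric S)
    (c : OpenPartialHomeomorph S ℂ) {A : Set S} (hA : MeasurableSet A) :
    σ.localArea c A = ∫⁻ z in c.target ∩ c.symm ⁻¹' A, ENNReal.ofReal (σ.coeff c z) := by
  rw [ConformalMetric.localArea, Measure.map_apply_of_aemeasurable (aemeasurable_chart_symm c _) hA,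
    withDensity_apply', Measure.restrict_restrict' c.open_target.measurableSet, Set.inter_comm]

theorem ConformalMetric.setLIntegral_localArea [MeasurableSpace S] [BorelSpace S]
    (σ : ConformalMetric S) {c : OpenPartialHomeomorph S ℂ} (hc : c ∈ atlas ℂ S)
    {A : Set S} (hA : MeasurableSet A) {u : S → ENNReal} (hu : Measurable u) :
    ∫⁻ x in A, u x ∂σ.localArea c =
      ∫⁻ z in c.target ∩ c.symm ⁻¹' A, ENNReal.ofReal (σ.coeff c z) * u (c.symm z) := by
  have hB := measurableSet_chart_preimage c hA
  rw [← lintegral_indicator hA, ConformalMetric.localArea,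
    lintegral_map' (hu.indicator hA).aemeasurable (aemeasurable_chart_symm c _),
    lintegral_withDensity_eq_lintegral_mul₀ (g := fun z => A.indicator u (c.symm z))
      (σ.aemeasurable_coeff hc) ((hu.indicator hA).comp_aemeasurable
        (c.continuousOn_symm.aemeasurable c.open_target.measurableSet)),
    ← lintegral_indicator c.open_target.measurableSet, ← lintegral_indicator hB]
  congr 1
  ext z
  by_cases h1 : z ∈ c.target <;> by_cases h2 : c.symm z ∈ A <;> simp [h1, h2, Set.indicator]

/-- Here `√det = σ (1 - |μ|²)`, and constant modulus turns the second factor into a scalar common to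
all charts. -/
theorem gMetric_area_eq_iSup [MeasurableSpace S] (σ : ConformalMetric S) (μ : BeltramiDifferential S) {k : ℝ}
    (hk : k ^ 2 ≤ 1) (hμ : ∀ c ∈ atlas ℂ S, ∀ z ∈ c.target, ‖μ.coeff c z‖ = k) :
    (gMetric σ μ).area = ⨆ c ∈ atlas ℂ S, ENNReal.ofReal (1 - k ^ 2) • σ.localArea c := by
  rw [RMetric.area]
  refine iSup_congr fun c => iSup_congr fun hc => ?_
  rw [ConformalMetric.localArea, ← Measure.map_smul, ← withDensity_smul' _ _ (by simp)]
  congr 1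
  refine withDensity_congr_ae ?_
  filter_upwards [ae_restrict_mem c.open_target.measurableSet] with z hz
  rw [gMetric_det, hμ c hc z hz, Real.sqrt_sq (mul_nonneg (σ.pos c hc z hz).le (by linarith)),
    Pi.smul_apply, smul_eq_mul, ← ENNReal.ofReal_mul (by linarith), mul_comm]

/-- A compatible family of measures on chart domains glues: their supremum restricts to each. -/
theorem iSup_atlas_restrict [MeasurableSpace S] [BorelSpace S] [SecondCountableTopology S]
    [Nonempty S] (m : OpenPartialHomeomorph S ℂ → Measure S)
    (h0 : ∀ c ∈ atlas ℂ S, m c c.sourceᶜ = 0)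
    (hm : ∀ c ∈ atlas ℂ S, ∀ c' ∈ atlas ℂ S, ∀ A, MeasurableSet A → A ⊆ c.source → A ⊆ c'.source →
      m c A = m c' A) {c : OpenPartialHomeomorph S ℂ} (hc : c ∈ atlas ℂ S) :
    (⨆ c ∈ atlas ℂ S, m c).restrict c.source = m c := by
  obtain ⟨s, hs, hcov⟩ := TopologicalSpace.countable_cover_nhds
    (fun x : S => (chartAt ℂ x).open_source.mem_nhds (mem_chart_source ℂ x))
  have hne : s.Nonempty := by
    by_contra h
    rw [Set.not_nonempty_iff_eq_empty] at h
    rw [h, Set.biUnion_empty] at hcov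
    exact Set.empty_ne_univ hcov
  obtain ⟨u, hu⟩ := hs.exists_eq_range hne
  set D := disjointed (fun n => (chartAt ℂ (u n)).source) with hD
  have hDm : ∀ n, MeasurableSet (D n) := fun n =>
    MeasurableSet.disjointed (fun i => (chartAt ℂ (u i)).open_source.measurableSet) n
  have hDd : Pairwise (Function.onFun Disjoint D) := disjoint_disjointed _
  have hDs : ∀ n, D n ⊆ (chartAt ℂ (u n)).source := fun n => disjointed_subset _ n
  have hDu : ⋃ n, D n = Set.univ := by
    rw [hD, iUnion_disjointed, ← hcov, hu, Set.biUnion_range]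
  have hsrc : ∀ c' ∈ atlas ℂ S, ∀ B, m c' B = m c' (B ∩ c'.source) := by
    intro c' hc' B
    refine (measure_inter_conull ?_).symm
    exact measure_mono_null (fun x hx hx' => hx hx') (h0 c' hc')
  -- The disjoint pieces `D n` cover `S`, each inside one chart, so `ν` is an explicit gluing. It
  -- agrees with every `m c'` on the domain of `c'`, hence bounds the supremum from above.
  set ν : Measure S := Measure.sum fun n => (m (chartAt ℂ (u n))).restrict (D n) with hν
  have key : ∀ c' ∈ atlas ℂ S, ∀ B, MeasurableSet B → m c' B = ν (B ∩ c'.source) := by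
    intro c' hc' B hB
    have hBc := hB.inter c'.open_source.measurableSet
    rw [hν, Measure.sum_apply _ hBc, hsrc c' hc' B]
    conv_lhs => rw [← Set.inter_univ (B ∩ c'.source), ← hDu, Set.inter_iUnion]
    rw [measure_iUnion (fun i j hij => (hDd hij).mono Set.inter_subset_right Set.inter_subset_right)
      (fun n => hBc.inter (hDm n))]
    congr 1
    ext n
    rw [Measure.restrict_apply hBc]
    exact hm c' hc' _ (chart_mem_atlas ℂ _) _ (hBc.inter (hDm n))
      (fun x hx => hx.1.2) (fun x hx => hDs n hx.2)
  have hle : (⨆ c ∈ atlas ℂ S, m c) ≤ ν := by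
    refine iSup₂_le fun c' hc' => Measure.le_iff.2 fun B hB => ?_
    rw [key c' hc' B hB]
    exact measure_mono Set.inter_subset_left
  ext B hB
  rw [Measure.restrict_apply hB]
  apply le_antisymm
  · rw [key c hc B hB]
    exact hle _
  · rw [hsrc c hc B]
    exact (le_iSup₂ (f := fun c (_ : c ∈ atlas ℂ S) => m c) c hc) _

end

/-! ### Change of variables and comparison of areas -/

section

variable {S₁ : Type*} [TopologicalSpace S₁] [ChartedSpace ℂ S₁]
  {S₂ : Type*} [TopologicalSpace S₂] [ChartedSpace ℂ S₂]
  [IsManifold 𝓘(ℂ) ω S₁] [IsManifold 𝓘(ℂ) ω S₂]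
  [MeasurableSpace S₁] [BorelSpace S₁] [MeasurableSpace S₂] [BorelSpace S₂]

/-- Change of variables between chart domains. -/
theorem ConformalMetric.localArea_image (ρ : ConformalMetric S₂)
    {c : OpenPartialHomeomorph S₁ ℂ} {c' : OpenPartialHomeomorph S₂ ℂ}
    (hc : c ∈ atlas ℂ S₁) (hc' : c' ∈ atlas ℂ S₂) {f : S₁ → S₂}
    (hf : ContMDiff 𝓘(ℝ, ℂ) 𝓘(ℝ, ℂ) ∞ f) {A : Set S₁} (hA : MeasurableSet A)
    (hfA : MeasurableSet (f '' A)) (hinj : Set.InjOn f A)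
    (hAc : A ⊆ c.source) (hAc' : ∀ x ∈ A, f x ∈ c'.source) :
    ρ.localArea c' (f '' A) = ∫⁻ z in c.target ∩ c.symm ⁻¹' A,
      ENNReal.ofReal |(chartDeriv c c' f (c.symm z)).det| *
        ENNReal.ofReal (ρ.coeff c' (c' (f (c.symm z)))) := by
  have hset : c'.target ∩ c'.symm ⁻¹' (f '' A) = (c' ∘ f ∘ c.symm) '' (c.target ∩ c.symm ⁻¹' A) := by
    ext w
    constructor
    · rintro ⟨hw, x, hx, hxw⟩
      refine ⟨c x, ⟨c.map_source (hAc hx), ?_⟩, ?_⟩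
      · simpa [c.left_inv (hAc hx)] using hx
      · simp [c.left_inv (hAc hx), hxw, c'.right_inv hw]
    · rintro ⟨z, ⟨hz, hzA⟩, rfl⟩
      refine ⟨c'.map_source (hAc' _ hzA), c.symm z, hzA, ?_⟩
      simp [c'.left_inv (hAc' _ hzA)]
  rw [ρ.localArea_apply c' hfA, hset,
    lintegral_image_eq_lintegral_abs_det_fderiv_mul volume (measurableSet_chart_preimage c hA)
      (f' := fun z => chartDeriv c c' f (c.symm z))]
  · rfl
  · rintro z ⟨hz, hzA⟩
    have h := ((differentiableAt_chart hc hc' hf.contMDiffAt (hAc hzA) (hAc' _ hzA)).differentiableAt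
      (by simp)).hasFDerivAt
    rw [c.right_inv hz] at h
    have h2 : fderiv ℝ (c' ∘ f ∘ c.symm) z = chartDeriv c c' f (c.symm z) := by
      rw [chartDeriv, c.right_inv hz]
    rw [← h2]
    exact h.hasFDerivWithinAt
  · rintro z ⟨hz, hzA⟩ w ⟨hw, hwA⟩ hzw
    exact c.symm.injOn hz hw (hinj hzA hwA (c'.injOn (hAc' _ hzA) (hAc' _ hwA) hzw))

end

section

variable {S : Type*} [TopologicalSpace S] [ChartedSpace ℂ S]
  [IsManifold 𝓘(ℂ) ω S] [MeasurableSpace S] [BorelSpace S]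

theorem linPart_mulCLM (a : ℂ) : linPart (mulCLM a) = a := by
  simp only [linPart, mulCLM_apply]
  linear_combination (-a / 2) * Complex.I_sq

theorem antiPart_mulCLM (a : ℂ) : antiPart (mulCLM a) = 0 := by
  simp only [antiPart, mulCLM_apply]
  linear_combination (a / 2) * Complex.I_sq

/-- Change of variables for the identity: a holomorphic transition with derivative `T` has Jacobian
`|T|²`, exactly the factor in the transformation law of `σ`. -/
theorem ConformalMetric.localArea_eq_of_subset (σ : ConformalMetric S)
    {c c' : OpenPartialHomeomorph S ℂ} (hc : c ∈ atlas ℂ S) (hc' : c' ∈ atlas ℂ S)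
    {A : Set S} (hA : MeasurableSet A) (hAc : A ⊆ c.source) (hAc' : A ⊆ c'.source) :
    σ.localArea c A = σ.localArea c' A := by
  have h := σ.localArea_image hc hc' (f := id) contMDiff_id hA (by simpa using hA)
    Function.injective_id.injOn hAc hAc'
  rw [Set.image_id] at h
  rw [h, σ.localArea_apply c hA]
  refine setLIntegral_congr_fun (measurableSet_chart_preimage c hA) ?_
  rintro z ⟨hz, hzA⟩
  have hx := hAc hzA
  have hx' := hAc' hzA
  have hd : chartDeriv c c' id (c.symm z) = mulCLM (deriv (c' ∘ c.symm) (c (c.symm z))) :=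
    (hasFDerivAt_transition hc hc' hx hx').fderiv
  have ht := σ.transform c hc c' hc' _ ⟨hx, hx'⟩
  simp only
  rw [← ENNReal.ofReal_mul (abs_nonneg _), det_eq_parts, hd, linPart_mulCLM, antiPart_mulCLM]
  rw [c.right_inv hz] at ht ⊢
  rw [ht]
  congr 1
  simp [mul_comm]

theorem ConformalMetric.localArea_compl (σ : ConformalMetric S) (c : OpenPartialHomeomorph S ℂ) :
    σ.localArea c c.sourceᶜ = 0 := by
  rw [σ.localArea_apply c c.open_source.measurableSet.compl]
  have : c.target ∩ c.symm ⁻¹' c.sourceᶜ = ∅ := by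
    ext z
    simp only [Set.mem_inter_iff, Set.mem_preimage, Set.mem_compl_iff, Set.mem_empty_iff_false,
      iff_false, not_and, not_not]
    exact fun h => c.map_target h
  rw [this, Measure.restrict_empty, lintegral_zero_measure]

theorem gMetric_area_restrict [SecondCountableTopology S] [Nonempty S] (σ : ConformalMetric S)
    (μ : BeltramiDifferential S) {k : ℝ} (hk : k ^ 2 ≤ 1)
    (hμ : ∀ c ∈ atlas ℂ S, ∀ z ∈ c.target, ‖μ.coeff c z‖ = k)
    {c : OpenPartialHomeomorph S ℂ} (hc : c ∈ atlas ℂ S) :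
    (gMetric σ μ).area.restrict c.source = ENNReal.ofReal (1 - k ^ 2) • σ.localArea c := by
  rw [gMetric_area_eq_iSup σ μ hk hμ]
  refine iSup_atlas_restrict (fun c => ENNReal.ofReal (1 - k ^ 2) • σ.localArea c) ?_ ?_ hc
  · intro c _
    simp [σ.localArea_compl c]
  · intro c hc c' hc' A hA h1 h2
    simp [σ.localArea_eq_of_subset hc hc' hA h1 h2]

theorem ConformalMetric.area_restrict [SecondCountableTopology S] [Nonempty S]
    (σ : ConformalMetric S) {c : OpenPartialHomeomorph S ℂ} (hc : c ∈ atlas ℂ S) :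
    σ.toRMetric.area.restrict c.source = σ.localArea c := by
  have h := gMetric_area_restrict σ zeroBeltrami (k := 0) (by simp) (by simp [zeroBeltrami]) hc
  simpa [ConformalMetric.toRMetric] using h

/-- For `μ` of constant modulus `k`, the area of `σ |dz + μ dz̄|²` is `1 - k²` times that of `σ |dz|²`. -/
theorem gMetric_area [SecondCountableTopology S] [Nonempty S] (σ : ConformalMetric S)
    (μ : BeltramiDifferential S) {k : ℝ} (hk : k ^ 2 ≤ 1)
    (hμ : ∀ c ∈ atlas ℂ S, ∀ z ∈ c.target, ‖μ.coeff c z‖ = k) :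
    (gMetric σ μ).area = ENNReal.ofReal (1 - k ^ 2) • σ.toRMetric.area := by
  obtain ⟨s, hs, hcov⟩ := exists_countable_iUnion_nhds (fun x : S => (chartAt ℂ x).source)
    (fun x => (chartAt ℂ x).open_source.mem_nhds (mem_chart_source ℂ x))
  have := hs.to_subtype
  rw [Measure.ext_iff_of_iUnion_eq_univ hcov]
  intro i
  rw [Measure.restrict_smul, gMetric_area_restrict σ μ hk hμ (chart_mem_atlas ℂ _),
    σ.area_restrict (chart_mem_atlas ℂ _)]

end

/-! ### Energy and Jacobian densities -/

section

variable {S₁ : Type*} [TopologicalSpace S₁] [ChartedSpace ℂ S₁]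
  {S₂ : Type*} [TopologicalSpace S₂] [ChartedSpace ℂ S₂]

/-- The density of the pull-back by `f` of the area of `ρ |dw|²` with respect to the area of
`σ |dz|²`, i.e. `ρ(f) |J f| / σ`. -/
noncomputable def jacDensity (σ : ConformalMetric S₁) (ρ : ConformalMetric S₂) (f : S₁ → S₂)
    (x : S₁) : ℝ :=
  ρ.at (f x) * |‖dz f x‖ ^ 2 - ‖dzbar f x‖ ^ 2| / σ.at x

theorem ConformalMetric.at_pos (σ : ConformalMetric S₁) (x : S₁) : 0 < σ.at x :=
  σ.pos _ (chart_mem_atlas ℂ x) _ (mem_chart_target ℂ x)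

theorem jacDensity_nonneg (σ : ConformalMetric S₁) (ρ : ConformalMetric S₂) (f : S₁ → S₂) (x : S₁) :
    0 ≤ jacDensity σ ρ f x :=
  div_nonneg (mul_nonneg (ρ.at_pos _).le (abs_nonneg _)) (σ.at_pos x).le

/-- The harmonic energy density is a multiple of the least squares Beltrami density plus the
signed Jacobian. -/
theorem normSqDf_eq_lbs_add (σ : ConformalMetric S₁) (μ : BeltramiDifferential S₁)
    (ρ : ConformalMetric S₂) {k : ℝ} (hμ : ∀ c ∈ atlas ℂ S₁, ∀ z ∈ c.target, ‖μ.coeff c z‖ = k)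
    (f : S₁ → S₂) (x : S₁) :
    (1 - k ^ 2) * (1 / 2 * normSqDf (gMetric σ μ) ρ f x) =
      2 / (1 - k ^ 2) * (ρ.at (f x) / σ.at x * ‖dzbar f x - μ.at x * dz f x‖ ^ 2) +
        ρ.at (f x) * (‖dz f x‖ ^ 2 - ‖dzbar f x‖ ^ 2) / σ.at x := by
  have hk1 : ‖μ.at x‖ = k := hμ _ (chart_mem_atlas ℂ x) _ (mem_chart_target ℂ x)
  have hk3 : 0 < 1 - k ^ 2 := by
    obtain ⟨l, hl, hb⟩ := μ.bound
    have : ‖μ.at x‖ ≤ l := hb _ (chart_mem_atlas ℂ x) _ (mem_chart_target ℂ x)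
    have := norm_nonneg (μ.at x)
    nlinarith
  have hσ := σ.at_pos x
  rw [normSqDf_eq, normSq_parts_identity, hk1]
  field_simp
  ring

variable [IsManifold 𝓘(ℂ) ω S₁] [IsManifold 𝓘(ℂ) ω S₂]

/-- The values `dz f x` and `σ.at x` refer to preferred charts, which may jump with `x`, so
regularity must be read in fixed charts. Here `a` and `b` are the derivatives of the chart changes
at `x` and `f x`; they cancel in the invariant densities. -/
theorem exists_chart_factors (σ : ConformalMetric S₁) (ρ : ConformalMetric S₂)
    {c : OpenPartialHomeomorph S₁ ℂ} {c' : OpenPartialHomeomorph S₂ ℂ}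
    (hc : c ∈ atlas ℂ S₁) (hc' : c' ∈ atlas ℂ S₂)
    {f : S₁ → S₂} {x : S₁} (hf : ContMDiffAt 𝓘(ℝ, ℂ) 𝓘(ℝ, ℂ) ∞ f x)
    (hx : x ∈ c.source) (hx' : f x ∈ c'.source) :
    ∃ a b : ℂ, a ≠ 0 ∧ b ≠ 0 ∧
      dz f x = b * a * linPart (chartDeriv c c' f x) ∧
      dzbar f x = b * starRingEnd ℂ a * antiPart (chartDeriv c c' f x) ∧
      σ.at x = σ.coeff c (c x) * ‖a‖ ^ 2 ∧ ρ.coeff c' (c' (f x)) = ρ.at (f x) * ‖b‖ ^ 2 ∧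
      ∀ μ : BeltramiDifferential S₁, μ.at x = μ.coeff c (c x) * (starRingEnd ℂ a / a) := by
  have ha := chart_mem_atlas ℂ x
  have hb := chart_mem_atlas ℂ (f x)
  have hxa := mem_chart_source ℂ x
  have hxb := mem_chart_source ℂ (f x)
  have h := chartDeriv_change ha hc hb hc' hf hxa hx hxb hx'
  refine ⟨_, _, σ.deriv_transition_ne_zero ha hc hxa hx, ρ.deriv_transition_ne_zero hc' hb hx' hxb,
    ?_, ?_, σ.transform _ ha c hc x ⟨hxa, hx⟩, ρ.transform c' hc' _ hb _ ⟨hx', hxb⟩,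
    fun μ => μ.transform _ ha c hc x ⟨hxa, hx⟩⟩
  · change linPart (chartDeriv (chartAt ℂ x) (chartAt ℂ (f x)) f x) = _
    rw [h, linPart_comp]
  · change antiPart (chartDeriv (chartAt ℂ x) (chartAt ℂ (f x)) f x) = _
    rw [h, antiPart_comp]

theorem jacDensity_eq_chart (σ : ConformalMetric S₁) (ρ : ConformalMetric S₂)
    {c : OpenPartialHomeomorph S₁ ℂ} {c' : OpenPartialHomeomorph S₂ ℂ}
    (hc : c ∈ atlas ℂ S₁) (hc' : c' ∈ atlas ℂ S₂)
    {f : S₁ → S₂} {x : S₁} (hf : ContMDiffAt 𝓘(ℝ, ℂ) 𝓘(ℝ, ℂ) ∞ f x)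
    (hx : x ∈ c.source) (hx' : f x ∈ c'.source) :
    jacDensity σ ρ f x =
      ρ.coeff c' (c' (f x)) * |(chartDeriv c c' f x).det| / σ.coeff c (c x) := by
  obtain ⟨a, b, ha, hb, hz, hzb, hs, hr, -⟩ := exists_chart_factors σ ρ hc hc' hf hx hx'
  rw [jacDensity, hz, hzb, hs, hr, det_eq_parts]
  have e : ‖b * a * linPart (chartDeriv c c' f x)‖ ^ 2 -
      ‖b * starRingEnd ℂ a * antiPart (chartDeriv c c' f x)‖ ^ 2 =
      (‖b‖ ^ 2 * ‖a‖ ^ 2) * (‖linPart (chartDeriv c c' f x)‖ ^ 2 -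
        ‖antiPart (chartDeriv c c' f x)‖ ^ 2) := by
    simp only [norm_mul, Complex.norm_conj]; ring
  rw [e, abs_mul, abs_of_nonneg (by positivity)]
  have hna := norm_pos_iff.2 ha
  have hσ := σ.pos c hc _ (c.map_source hx)
  field_simp

/-- The density of the harmonic energy in charts. -/
theorem normSqDf_eq_chart (σ : ConformalMetric S₁) (μ : BeltramiDifferential S₁)
    (ρ : ConformalMetric S₂) {k : ℝ} (hμ : ∀ c ∈ atlas ℂ S₁, ∀ z ∈ c.target, ‖μ.coeff c z‖ = k)
    {c : OpenPartialHomeomorph S₁ ℂ} {c' : OpenPartialHomeomorph S₂ ℂ}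
    (hc : c ∈ atlas ℂ S₁) (hc' : c' ∈ atlas ℂ S₂)
    {f : S₁ → S₂} {x : S₁} (hf : ContMDiffAt 𝓘(ℝ, ℂ) 𝓘(ℝ, ℂ) ∞ f x)
    (hx : x ∈ c.source) (hx' : f x ∈ c'.source) :
    1 / 2 * normSqDf (gMetric σ μ) ρ f x =
      ρ.coeff c' (c' (f x)) / (σ.coeff c (c x) * (1 - k ^ 2) ^ 2) *
        ((1 + k ^ 2) * (‖antiPart (chartDeriv c c' f x)‖ ^ 2 + ‖linPart (chartDeriv c c' f x)‖ ^ 2) -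
          4 * (μ.coeff c (c x) * (linPart (chartDeriv c c' f x) *
            starRingEnd ℂ (antiPart (chartDeriv c c' f x)))).re) := by
  obtain ⟨a, b, ha, hb, hz, hzb, hs, hr, hm⟩ := exists_chart_factors σ ρ hc hc' hf hx hx'
  have hk1 : ‖μ.at x‖ = k := hμ _ (chart_mem_atlas ℂ x) _ (mem_chart_target ℂ x)
  have hk2 : ‖μ.coeff c (c x)‖ = k := hμ _ hc _ (c.map_source hx)
  rw [normSqDf_eq, hk1, ← hk2, ← normSq_parts_expand, hz, hzb, hs, hr, hm]
  have hk3 : 0 < 1 - k ^ 2 := by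
    obtain ⟨l, hl, hb⟩ := μ.bound
    have := hb _ hc _ (c.map_source hx)
    have := norm_nonneg (μ.coeff c (c x))
    nlinarith
  generalize linPart (chartDeriv c c' f x) = B
  generalize antiPart (chartDeriv c c' f x) = A
  generalize μ.coeff c (c x) = m at *
  have hna := norm_pos_iff.2 ha
  have hσ := σ.pos c hc _ (c.map_source hx)
  have hca : starRingEnd ℂ a ≠ 0 := by simpa using ha
  have e1 : b * starRingEnd ℂ a * A - m * (starRingEnd ℂ a / a) * (b * a * B) =
      b * starRingEnd ℂ a * (A - m * B) := by field_simp
  have e2 : b * a * B - starRingEnd ℂ (m * (starRingEnd ℂ a / a)) * (b * starRingEnd ℂ a * A) =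
      b * a * (B - starRingEnd ℂ m * A) := by
    simp only [map_mul, map_div₀, Complex.conj_conj]; field_simp
  rw [e1, e2]
  simp only [norm_mul, Complex.norm_conj, hk2]
  field_simp

theorem continuous_jacDensity (σ : ConformalMetric S₁) (ρ : ConformalMetric S₂) {f : S₁ → S₂}
    (hf : ContMDiff 𝓘(ℝ, ℂ) 𝓘(ℝ, ℂ) ∞ f) : Continuous (jacDensity σ ρ f) := by
  rw [continuous_iff_continuousAt]
  intro x
  have ha := chart_mem_atlas ℂ x
  have hb := chart_mem_atlas ℂ (f x)
  have hxa := mem_chart_source ℂ x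
  have hxb := mem_chart_source ℂ (f x)
  have hF : ContMDiff (𝓘(ℝ, ℝ).prod 𝓘(ℝ, ℂ)) 𝓘(ℝ, ℂ) ∞ (fun p : ℝ × S₁ => (fun _ => f) p.1 p.2) :=
    hf.comp contMDiff_snd
  have hD : ContinuousAt (fun y => chartDeriv (chartAt ℂ x) (chartAt ℂ (f x)) f y) x :=
    ContinuousAt.comp (f := fun y => ((0 : ℝ), y))
      (g := fun p : ℝ × S₁ => chartDeriv (chartAt ℂ x) (chartAt ℂ (f x)) f p.2)
      (continuousAt_chartDeriv (F := fun _ => f) ha hb hF (t := 0) hxa hxb) (by fun_prop)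
  have hdet : Continuous (fun L : ℂ →L[ℝ] ℂ => L.det) := ContinuousLinearMap.continuous_det
  have hρ : ContinuousAt (fun y => ρ.coeff (chartAt ℂ (f x)) (chartAt ℂ (f x) (f y))) x := by
    have h1 := ((ρ.smooth _ hb).continuousOn).continuousAt
      ((chartAt ℂ (f x)).open_target.mem_nhds (mem_chart_target ℂ (f x)))
    exact ContinuousAt.comp (f := chartAt ℂ (f x) ∘ f) h1
      (((chartAt ℂ (f x)).continuousAt hxb).comp hf.continuous.continuousAt)
  have hσ : ContinuousAt (fun y => σ.coeff (chartAt ℂ x) (chartAt ℂ x y)) x := by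
    have h1 := ((σ.smooth _ ha).continuousOn).continuousAt
      ((chartAt ℂ x).open_target.mem_nhds (mem_chart_target ℂ x))
    exact h1.comp ((chartAt ℂ x).continuousAt hxa)
  have h := (hρ.mul (hdet.continuousAt.comp hD).abs).div hσ (σ.at_pos x).ne'
  refine h.congr ?_
  filter_upwards [(chartAt ℂ x).open_source.mem_nhds hxa,
    hf.continuous.continuousAt.eventually_mem ((chartAt ℂ (f x)).open_source.mem_nhds hxb)]
    with y h1 h2
  exact (jacDensity_eq_chart σ ρ ha hb hf.contMDiffAt h1 h2).symm

/-- Change of variables for a smooth homeomorphism of surfaces. -/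
theorem setLIntegral_jacDensity [SecondCountableTopology S₁] [SecondCountableTopology S₂]
    [Nonempty S₁] [Nonempty S₂]
    [MeasurableSpace S₁] [BorelSpace S₁] [MeasurableSpace S₂] [BorelSpace S₂]
    (σ : ConformalMetric S₁) (ρ : ConformalMetric S₂) (f : S₁ ≃ₜ S₂)
    (hf : ContMDiff 𝓘(ℝ, ℂ) 𝓘(ℝ, ℂ) ∞ f) {A : Set S₁} (hA : MeasurableSet A) :
    ∫⁻ x in A, ENNReal.ofReal (jacDensity σ ρ f x) ∂σ.toRMetric.area =
      ρ.toRMetric.area (f '' A) := by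
  have hmeas : Measurable (fun x => ENNReal.ofReal (jacDensity σ ρ f x)) :=
    (continuous_jacDensity σ ρ hf).measurable.ennreal_ofReal
  -- Equality of measures is local: it suffices to check it on countably many open sets, each mapped
  -- by `f` from one chart domain into another.
  have key : σ.toRMetric.area.withDensity (fun x => ENNReal.ofReal (jacDensity σ ρ f x)) =
      ρ.toRMetric.area.map f.symm := by
    obtain ⟨s, hs, hcov⟩ := exists_countable_iUnion_nhds
      (fun x : S₁ => (chartAt ℂ x).source ∩ f ⁻¹' (chartAt ℂ (f x)).source)
      (fun x => Filter.inter_mem ((chartAt ℂ x).open_source.mem_nhds (mem_chart_source ℂ x))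
        (f.continuous.continuousAt.eventually_mem
          ((chartAt ℂ (f x)).open_source.mem_nhds (mem_chart_source ℂ (f x)))))
    have := hs.to_subtype
    rw [Measure.ext_iff_of_iUnion_eq_univ hcov]
    rintro ⟨x, hx⟩
    ext A hA
    have hU : MeasurableSet ((chartAt ℂ x).source ∩ f ⁻¹' (chartAt ℂ (f x)).source) :=
      ((chartAt ℂ x).open_source.inter
        ((chartAt ℂ (f x)).open_source.preimage f.continuous)).measurableSet
    rw [Measure.restrict_apply hA, Measure.restrict_apply hA]
    have hB := hA.inter hU
    set B := A ∩ ((chartAt ℂ x).source ∩ f ⁻¹' (chartAt ℂ (f x)).source)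
    have hB1 : B ⊆ (chartAt ℂ x).source := fun y hy => hy.2.1
    have hB2 : ∀ y ∈ B, f y ∈ (chartAt ℂ (f x)).source := fun y hy => hy.2.2
    have hfB : MeasurableSet (f '' B) := by
      simpa using f.toMeasurableEquiv.measurableSet_image.2 hB
    rw [withDensity_apply _ hB, Measure.map_apply f.symm.measurable hB]
    have e1 : f.symm ⁻¹' B = f '' B := (f.image_eq_preimage_symm B).symm
    have e2 : ρ.toRMetric.area (f '' B) = ρ.localArea (chartAt ℂ (f x)) (f '' B) := by
      rw [← ρ.area_restrict (chart_mem_atlas ℂ (f x)), Measure.restrict_apply hfB,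
        Set.inter_eq_left.2]
      rintro _ ⟨y, hy, rfl⟩
      exact hB2 y hy
    have e3 : σ.toRMetric.area.restrict B = (σ.localArea (chartAt ℂ x)).restrict B := by
      rw [← σ.area_restrict (chart_mem_atlas ℂ x), Measure.restrict_restrict hB,
        Set.inter_eq_left.2 hB1]
    rw [e1, e2, e3, σ.setLIntegral_localArea (chart_mem_atlas ℂ x) hB hmeas,
      ρ.localArea_image (chart_mem_atlas ℂ x) (chart_mem_atlas ℂ (f x)) hf hB hfB
        f.injective.injOn hB1 hB2]
    refine setLIntegral_congr_fun (measurableSet_chart_preimage _ hB) ?_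
    rintro z ⟨hz, hzB⟩
    simp only
    rw [jacDensity_eq_chart σ ρ (chart_mem_atlas ℂ x) (chart_mem_atlas ℂ (f x)) hf.contMDiffAt
      (hB1 hzB) (hB2 _ hzB), (chartAt ℂ x).right_inv hz]
    have hσ := σ.pos _ (chart_mem_atlas ℂ x) z hz
    rw [← ENNReal.ofReal_mul hσ.le, ← ENNReal.ofReal_mul (abs_nonneg _)]
    congr 1
    field_simp
  rw [← withDensity_apply _ hA, key, Measure.map_apply f.symm.measurable hA]
  congr 1
  exact (f.image_eq_preimage_symm A).symm

end

/-! ### Small compactly supported variations of a diffeomorphism -/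

section

variable {S₁ : Type*} [TopologicalSpace S₁] [ChartedSpace ℂ S₁]
  {S₂ : Type*} [TopologicalSpace S₂] [ChartedSpace ℂ S₂]

theorem det_dmap (f : S₁ → S₂) (x : S₁) : (dmap f x).det = ‖dz f x‖ ^ 2 - ‖dzbar f x‖ ^ 2 :=
  det_eq_parts _

theorem dmap_congr {f g : S₁ → S₂} {x : S₁} (h : f =ᶠ[𝓝 x] g) : dmap f x = dmap g x := by
  rw [dmap, dmap, h.self_of_nhds]
  refine Filter.EventuallyEq.fderiv_eq ?_
  have hs : Filter.Tendsto (chartAt ℂ x).symm (𝓝 (chartAt ℂ x x)) (𝓝 x) := by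
    have := (chartAt ℂ x).continuousAt_symm (mem_chart_target ℂ x)
    rwa [ContinuousAt, (chartAt ℂ x).left_inv (mem_chart_source ℂ x)] at this
  filter_upwards [hs.eventually h] with z hz
  simp [hz]

theorem contMDiff_const_family {f : S₁ → S₂} (hf : ContMDiff 𝓘(ℝ, ℂ) 𝓘(ℝ, ℂ) ∞ f) :
    ContMDiff (𝓘(ℝ, ℝ).prod 𝓘(ℝ, ℂ)) 𝓘(ℝ, ℂ) ∞ (fun p : ℝ × S₁ => (fun _ : ℝ => f) p.1 p.2) :=
  hf.comp contMDiff_snd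

variable [IsManifold 𝓘(ℂ) ω S₁] [IsManifold 𝓘(ℂ) ω S₂]

/-- Open scaling invariant conditions on `|f_z|` and `|f_z̄|` persist along a smooth family. -/
theorem eventually_norm_dz_dzbar (σ : ConformalMetric S₁) (ρ : ConformalMetric S₂)
    {P : ℝ → ℝ → Prop} (hopen : IsOpen {p : ℝ × ℝ | P p.1 p.2})
    (hscale : ∀ r u v, 0 < r → (P (r * u) (r * v) ↔ P u v))
    {F : ℝ → S₁ → S₂}
    (hF : ContMDiff (𝓘(ℝ, ℝ).prod 𝓘(ℝ, ℂ)) 𝓘(ℝ, ℂ) ∞ (fun p : ℝ × S₁ => F p.1 p.2))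
    {t : ℝ} {x : S₁} (h : P ‖dz (F t) x‖ ‖dzbar (F t) x‖) :
    ∀ᶠ p : ℝ × S₁ in 𝓝 (t, x), P ‖dz (F p.1) p.2‖ ‖dzbar (F p.1) p.2‖ := by
  have ha := chart_mem_atlas ℂ x
  have hb := chart_mem_atlas ℂ (F t x)
  have hxa := mem_chart_source ℂ x
  have hxb := mem_chart_source ℂ (F t x)
  -- Passing to fixed charts multiplies both norms by the same positive number, which `hscale`
  -- absorbs.
  have key : ∀ s y, y ∈ (chartAt ℂ x).source → F s y ∈ (chartAt ℂ (F t x)).source →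
      (P ‖dz (F s) y‖ ‖dzbar (F s) y‖ ↔
        P ‖linPart (chartDeriv (chartAt ℂ x) (chartAt ℂ (F t x)) (F s) y)‖
          ‖antiPart (chartDeriv (chartAt ℂ x) (chartAt ℂ (F t x)) (F s) y)‖) := by
    intro s y h1 h2
    obtain ⟨a, b, ha0, hb0, hz, hzb, -⟩ :=
      exists_chart_factors σ ρ ha hb (contMDiff_slice hF s).contMDiffAt h1 h2
    rw [hz, hzb]
    simp only [norm_mul, Complex.norm_conj]
    exact hscale _ _ _ (mul_pos (norm_pos_iff.2 hb0) (norm_pos_iff.2 ha0))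
  have hD := continuousAt_chartDeriv ha hb hF hxa hxb
  have hl : Continuous (fun L : ℂ →L[ℝ] ℂ => (‖linPart L‖, ‖antiPart L‖)) := by
    unfold linPart antiPart
    fun_prop
  have hc := ContinuousAt.comp (f := fun p : ℝ × S₁ =>
    chartDeriv (chartAt ℂ x) (chartAt ℂ (F t x)) (F p.1) p.2) hl.continuousAt hD
  have n0 := hc.eventually_mem (hopen.mem_nhds ((key t x hxa hxb).1 h))
  have n1 : ∀ᶠ p : ℝ × S₁ in 𝓝 (t, x), p.2 ∈ (chartAt ℂ x).source :=
    continuousAt_snd.eventually_mem ((chartAt ℂ x).open_source.mem_nhds hxa)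
  have n2 : ∀ᶠ p : ℝ × S₁ in 𝓝 (t, x), F p.1 p.2 ∈ (chartAt ℂ (F t x)).source :=
    hF.continuous.continuousAt.eventually_mem ((chartAt ℂ (F t x)).open_source.mem_nhds hxb)
  filter_upwards [n0, n1, n2] with p h0 h1 h2
  exact (key p.1 p.2 h1 h2).2 h0

/-- A smooth family is injective, locally uniformly, near a point where the derivative is
invertible. -/
theorem eventually_eq_of_apply_eq {F : ℝ → S₁ → S₂}
    (hF : ContMDiff (𝓘(ℝ, ℝ).prod 𝓘(ℝ, ℂ)) 𝓘(ℝ, ℂ) ∞ (fun p : ℝ × S₁ => F p.1 p.2))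
    {t : ℝ} {x : S₁} (h : (dmap (F t) x).det ≠ 0) :
    ∀ᶠ p : ℝ × S₁ × S₁ in 𝓝 (t, x, x), F p.1 p.2.1 = F p.1 p.2.2 → p.2.1 = p.2.2 := by
  have ha := chart_mem_atlas ℂ x
  have hb := chart_mem_atlas ℂ (F t x)
  have hxa := mem_chart_source ℂ x
  have hxb := mem_chart_source ℂ (F t x)
  set c := chartAt ℂ x
  set c' := chartAt ℂ (F t x)
  have hs := hasStrictFDerivAt_familyRep ha hb hF (mem_familyDomain (t := t) hxa hxb)
  have hD : (familyDeriv c c' F (t, c x)).det ≠ 0 := by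
    rw [← chartDeriv_eq_familyDeriv ha hb hF hxa hxb]
    exact h
  set D := ContinuousLinearMap.toContinuousLinearEquivOfDetNeZero _ hD with hDdef
  have hDapp : ∀ u, D u = familyDeriv c c' F (t, c x) u := fun u => rfl
  obtain ⟨ε, hε, hanti⟩ : ∃ ε > 0, ∀ u, ε * ‖u‖ ≤ ‖D u‖ := by
    refine ⟨(‖(D.symm : ℂ →L[ℝ] ℂ)‖ + 1)⁻¹, by positivity, fun u => ?_⟩
    have h1 : ‖u‖ ≤ ‖(D.symm : ℂ →L[ℝ] ℂ)‖ * ‖D u‖ := by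
      simpa using (D.symm : ℂ →L[ℝ] ℂ).le_opNorm (D u)
    rw [inv_mul_le_iff₀ (by positivity)]
    nlinarith [norm_nonneg (D u)]
  -- Equal values at one time would give `ε‖u‖ ≤ (ε/2)‖u‖` for the purely spatial difference `u`,
  -- hence `u = 0`.
  have hlo := hs.isLittleO.def (half_pos hε)
  have hcx : ContinuousAt c x := c.continuousAt hxa
  have hten : Filter.Tendsto (fun p : ℝ × S₁ × S₁ => ((p.1, c p.2.1), (p.1, c p.2.2)))
      (𝓝 (t, x, x)) (𝓝 ((t, c x), (t, c x))) := by
    have e1 : ContinuousAt (fun p : ℝ × S₁ × S₁ => c p.2.1) (t, x, x) :=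
      ContinuousAt.comp (f := fun p : ℝ × S₁ × S₁ => p.2.1) (g := c) hcx (by fun_prop)
    have e2 : ContinuousAt (fun p : ℝ × S₁ × S₁ => c p.2.2) (t, x, x) :=
      ContinuousAt.comp (f := fun p : ℝ × S₁ × S₁ => p.2.2) (g := c) hcx (by fun_prop)
    exact (continuousAt_fst.prodMk e1).prodMk (continuousAt_fst.prodMk e2)
  have n1 : ∀ᶠ p : ℝ × S₁ × S₁ in 𝓝 (t, x, x), p.2.1 ∈ c.source :=
    ContinuousAt.eventually_mem (f := fun p : ℝ × S₁ × S₁ => p.2.1) (by fun_prop)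
      (c.open_source.mem_nhds hxa)
  have n2 : ∀ᶠ p : ℝ × S₁ × S₁ in 𝓝 (t, x, x), p.2.2 ∈ c.source :=
    ContinuousAt.eventually_mem (f := fun p : ℝ × S₁ × S₁ => p.2.2) (by fun_prop)
      (c.open_source.mem_nhds hxa)
  filter_upwards [hten.eventually hlo, n1, n2] with ⟨s, y, z⟩ h0 h1 h2 heq
  simp only at h0 h1 h2 heq ⊢
  refine c.injOn h1 h2 ?_
  have e1 : familyRep c c' F (s, c y) = familyRep c c' F (s, c z) := by
    simp [familyRep, c.left_inv h1, c.left_inv h2, heq]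
  have e2 : ((s, c y) : ℝ × ℂ) - (s, c z) = (0, c y - c z) := by simp
  have e3 : fderiv ℝ (familyRep c c' F) (t, c x) (0, c y - c z) = D (c y - c z) := by
    rw [hDapp]; simp [familyDeriv]
  have e4 : ‖((0, c y - c z) : ℝ × ℂ)‖ = ‖c y - c z‖ := by simp [Prod.norm_def]
  rw [e1, e2, e3, e4, sub_self, zero_sub, norm_neg] at h0
  have h5 := hanti (c y - c z)
  have h6 : ‖c y - c z‖ ≤ 0 := by nlinarith
  exact sub_eq_zero.1 (norm_le_zero_iff.1 h6)

/-- A smooth map with invertible derivative everywhere is open. -/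
theorem isOpenMap_of_det_ne_zero {f : S₁ → S₂} (hf : ContMDiff 𝓘(ℝ, ℂ) 𝓘(ℝ, ℂ) ∞ f)
    (h : ∀ x, (dmap f x).det ≠ 0) : IsOpenMap f := by
  refine IsOpenMap.of_nhds_le fun x => ?_
  have ha := chart_mem_atlas ℂ x
  have hb := chart_mem_atlas ℂ (f x)
  have hxa := mem_chart_source ℂ x
  have hxb := mem_chart_source ℂ (f x)
  have hsd := (differentiableAt_chart ha hb hf.contMDiffAt hxa hxb).hasStrictFDerivAt
    (n := ∞) (by simp)
  have hmap := HasStrictFDerivAt.map_nhds_eq_of_equiv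
    (f' := ContinuousLinearMap.toContinuousLinearEquivOfDetNeZero _ (h x)) hsd
  set c := chartAt ℂ x
  set c' := chartAt ℂ (f x)
  have e0 : (c' ∘ f ∘ c.symm) (c x) = c' (f x) := by simp [c.left_inv hxa]
  have e1 : Filter.map c'.symm (𝓝 (c' (f x))) = 𝓝 (f x) := by
    have := c'.symm.map_nhds_eq (c'.map_source hxb)
    rwa [c'.left_inv hxb] at this
  rw [e0, ← c.map_nhds_eq hxa, Filter.map_map] at hmap
  rw [← e1, ← hmap, Filter.map_map]
  refine le_of_eq (Filter.map_congr ?_)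
  filter_upwards [c.open_source.mem_nhds hxa,
    hf.continuous.continuousAt.eventually_mem (c'.open_source.mem_nhds hxb)] with y h1 h2
  simp [c.left_inv h1, c'.left_inv h2]

/-- A smooth bijection with invertible derivative everywhere is a diffeomorphism. -/
theorem exists_diffeo_of_bijective {f : S₁ → S₂} (hf : ContMDiff 𝓘(ℝ, ℂ) 𝓘(ℝ, ℂ) ∞ f)
    (h : ∀ x, (dmap f x).det ≠ 0) (hbij : Function.Bijective f) :
    ∃ g : Diffeo S₁ S₂, ⇑g = f := by
  set H : S₁ ≃ₜ S₂ := (Equiv.ofBijective f hbij).toHomeomorphOfContinuousOpen hf.continuous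
    (isOpenMap_of_det_ne_zero hf h) with hH
  have hHf : ∀ x, H x = f x := fun x => rfl
  refine ⟨{ toEquiv := H.toEquiv, contMDiff_toFun := hf, contMDiff_invFun := ?_ }, rfl⟩
  intro y
  obtain ⟨x, rfl⟩ := H.surjective y
  change ContMDiffAt _ _ _ H.symm (H x)
  have hxb : H x ∈ (chartAt ℂ (H x)).source := mem_chart_source ℂ (H x)
  have hxa := mem_chart_source ℂ x
  rw [contMDiffAt_iff]
  refine ⟨H.symm.continuous.continuousAt, ?_⟩
  simp only [extChartAt, H.symm_apply_apply, mfld_simps, contDiffWithinAt_univ]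
  set c := chartAt ℂ x with hc
  set c' := chartAt ℂ (H x) with hc'
  -- With a continuous inverse already available, smoothness of the inverse follows in charts from
  -- the invertible derivative.
  set e : OpenPartialHomeomorph ℂ ℂ := c.symm ≫ₕ H.toOpenPartialHomeomorph ≫ₕ c' with he
  have hes : e.symm (c' (H x)) = c x := by simp [he, c'.left_inv hxb]
  have hd := differentiableAt_chart (chart_mem_atlas ℂ x) (chart_mem_atlas ℂ (H x))
    hf.contMDiffAt hxa hxb
  have hef : (e : ℂ → ℂ) = c' ∘ f ∘ c.symm := rfl
  have hsymm : (e.symm : ℂ → ℂ) = c ∘ H.symm ∘ c'.symm := rfl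
  have key := e.contDiffAt_symm (n := ∞) (a := c' (H x))
    (f₀' := ContinuousLinearMap.toContinuousLinearEquivOfDetNeZero _ (h x))
    (by simp [he, c'.map_source hxb, c'.left_inv hxb, hxa]) (by
      rw [hes, hef]; exact (hd.differentiableAt (by simp)).hasFDerivAt) (by
      rw [hes, hef]; exact hd)
  rw [hsymm] at key
  exact key

/-- Chain rule for `f⁻¹ ∘ f` in charts, followed by determinants. -/
theorem Diffeo.det_ne_zero (f : Diffeo S₁ S₂) (x : S₁) : (dmap f x).det ≠ 0 := by
  have ha := chart_mem_atlas ℂ x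
  have hb := chart_mem_atlas ℂ (f x)
  have hxa := mem_chart_source ℂ x
  have hxb := mem_chart_source ℂ (f x)
  have h1 := ((differentiableAt_chart ha hb f.contMDiff_toFun.contMDiffAt hxa hxb).differentiableAt
    (by simp)).hasFDerivAt
  have h2 := ((differentiableAt_chart hb ha (x := f x) f.contMDiff_invFun.contMDiffAt hxb
    (by simp)).differentiableAt (by simp)).hasFDerivAt
  set c := chartAt ℂ x
  set c' := chartAt ℂ (f x)
  have e0 : (c' ∘ f ∘ c.symm) (c x) = c' (f x) := by simp [c.left_inv hxa]
  have h3 := HasFDerivAt.comp (c x) (by rw [show (c' ∘ ⇑f.toEquiv ∘ c.symm) (c x) = c' (f x) from e0]; exact h2) h1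
  have h4 : HasFDerivAt (fun z : ℂ => z) (ContinuousLinearMap.id ℝ ℂ) (c x) := hasFDerivAt_id _
  have h5 := h3.unique (h4.congr_of_eventuallyEq ?_)
  · have h6 := congrArg ContinuousLinearMap.det h5
    intro h0
    have h7 : (fderiv ℝ (c' ∘ f.toEquiv ∘ c.symm) (c x)).det = 0 := h0
    have h8 : (ContinuousLinearMap.id ℝ ℂ).det = 1 := by simp [ContinuousLinearMap.det]
    have h9 : ∀ A B : ℂ →L[ℝ] ℂ, (A ∘L B).det = A.det * B.det := fun A B =>
      LinearMap.det_comp (A : ℂ →ₗ[ℝ] ℂ) (B : ℂ →ₗ[ℝ] ℂ)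
    rw [h8, h9, h7, mul_zero] at h6
    exact zero_ne_one h6
  · have n1 : ∀ᶠ z in 𝓝 (c x), z ∈ c.target := c.open_target.mem_nhds (c.map_source hxa)
    have n2 : ∀ᶠ z in 𝓝 (c x), f (c.symm z) ∈ c'.source := by
      have hcs := c.continuousAt_symm (c.map_source hxa)
      have : ContinuousAt (f ∘ c.symm) (c x) :=
        ContinuousAt.comp f.contMDiff_toFun.continuous.continuousAt hcs
      exact this.eventually_mem (c'.open_source.mem_nhds (by simpa [c.left_inv hxa] using hxb))
    filter_upwards [n1, n2] with z h1 h2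
    have : c'.symm (c' (f (c.symm z))) = f (c.symm z) := c'.left_inv h2
    simp [this, c.right_inv h1]

end

/-- A compact set is closed here, so off `K` the maps agree as germs and have equal derivatives. -/
theorem eventuallyEq_of_notMem {X Y : Type*} [TopologicalSpace X] [T2Space X] {K : Set X}
    (hK : IsCompact K) {f g : X → Y} (h : ∀ x ∉ K, g x = f x) {x : X} (hx : x ∉ K) :
    g =ᶠ[𝓝 x] f := by
  filter_upwards [hK.isClosed.isOpen_compl.mem_nhds hx] with y hy using h y hy

section

variable {S₁ : Type*} [TopologicalSpace S₁] [ChartedSpace ℂ S₁]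
  {S₂ : Type*} [TopologicalSpace S₂] [ChartedSpace ℂ S₂]

/-- The image of `K` in `S₁'` is compact, hence closed, and misses every boundary point; near the
boundary the two maps coincide. -/
theorem mem_boundaryClass_of_eqOn_compl {S₁' : Type*} [TopologicalSpace S₁'] [T2Space S₁']
    {S₂' : Type*} [TopologicalSpace S₂'] {j₁ : S₁ → S₁'} (hj₁ : Continuous j₁) {j₂ : S₂ → S₂'}
    {h : S₁' → S₂'} {f g : Diffeo S₁ S₂} (hf : f ∈ boundaryClass j₁ j₂ h) {K : Set S₁}
    (hK : IsCompact K) (hg : ∀ x ∉ K, g x = f x) : g ∈ boundaryClass j₁ j₂ h := by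
  intro p hp
  refine (hf p hp).congr' ?_
  have hc : (j₁ '' K)ᶜ ∈ 𝓝 p := (hK.image hj₁).isClosed.isOpen_compl.mem_nhds
    fun ⟨x, _, hx⟩ => hp ⟨x, hx⟩
  filter_upwards [Filter.preimage_mem_comap hc] with x hx
  rw [Function.comp_apply, Function.comp_apply, hg x fun hxK => hx ⟨x, hxK, rfl⟩]

variable [IsManifold 𝓘(ℂ) ω S₁] [IsManifold 𝓘(ℂ) ω S₂]

/-- A compactly supported variation of a diffeomorphism consists of diffeomorphisms for small
times. -/
theorem eventually_exists_diffeo [T2Space S₁] [T2Space S₂] [Nonempty S₁] [ConnectedSpace S₂]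
    (σ : ConformalMetric S₁) (ρ : ConformalMetric S₂)
    (f : Diffeo S₁ S₂) {K : Set S₁} {F : ℝ → S₁ → S₂} (hK : IsCompact K)
    (hF : ContMDiff (𝓘(ℝ, ℝ).prod 𝓘(ℝ, ℂ)) 𝓘(ℝ, ℂ) ∞ (fun p : ℝ × S₁ => F p.1 p.2))
    (h0 : F 0 = f) (hoff : ∀ t, ∀ x ∉ K, F t x = f x) :
    ∀ᶠ t in 𝓝 (0 : ℝ), ∃ g : Diffeo S₁ S₂, ⇑g = F t := by
  have hdet : ∀ᶠ t in 𝓝 (0 : ℝ), ∀ x ∈ K, ‖dz (F t) x‖ ≠ ‖dzbar (F t) x‖ := by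
    refine hK.eventually_forall_of_forall_eventually fun x _ => ?_
    refine eventually_norm_dz_dzbar σ ρ (P := fun u v => u ≠ v) ?_ ?_ hF ?_
    · exact (isClosed_eq continuous_fst continuous_snd).isOpen_compl
    · intro r u v hr
      simp [hr.ne']
    · have := f.det_ne_zero x
      rw [det_dmap] at this
      rw [h0]
      intro h
      rw [h] at this
      simp at this
  have hloc : ∀ x, ∀ᶠ p : ℝ × S₁ × S₁ in 𝓝 (0, x, x), F p.1 p.2.1 = F p.1 p.2.2 → p.2.1 = p.2.2 :=
    fun x => eventually_eq_of_apply_eq hF (by rw [h0]; exact f.det_ne_zero x)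
  -- Near the diagonal this is the uniform local injectivity `hloc`; away from it, distinct values
  -- stay distinct by continuity. Compactness of `K ×ˢ K` makes the time interval uniform.
  have hinj1 : ∀ᶠ t in 𝓝 (0 : ℝ), ∀ p ∈ K ×ˢ K, F t p.1 = F t p.2 → p.1 = p.2 := by
    refine (hK.prod hK).eventually_forall_of_forall_eventually ?_
    rintro ⟨x, y⟩ -
    by_cases hxy : x = y
    · subst hxy
      exact hloc x
    · have hne : F 0 x ≠ F 0 y := by
        rw [h0]; exact fun h => hxy (f.injective h)
      have hc1 : Continuous (fun p : ℝ × S₁ × S₁ => F p.1 p.2.1) :=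
        hF.continuous.comp (f := fun p : ℝ × S₁ × S₁ => (p.1, p.2.1)) (by fun_prop)
      have hc2 : Continuous (fun p : ℝ × S₁ × S₁ => F p.1 p.2.2) :=
        hF.continuous.comp (f := fun p : ℝ × S₁ × S₁ => (p.1, p.2.2)) (by fun_prop)
      filter_upwards [(isOpen_ne_fun hc1 hc2).mem_nhds (show ((0 : ℝ), x, y) ∈ _ from hne)]
        with p hp h using absurd h hp
  -- The point `y` ranges over a non-compact set, but a collision forces `y = f⁻¹(F t x)`, which is
  -- near `x` for small `t`, so `hloc` applies again.
  have hinj2 : ∀ᶠ t in 𝓝 (0 : ℝ), ∀ x ∈ K, ∀ y ∉ K, F t x = F t y → x = y := by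
    refine hK.eventually_forall_of_forall_eventually fun x _ => ?_
    have hc : Continuous (fun p : ℝ × S₁ => (p.1, p.2, f.symm (F p.1 p.2))) :=
      continuous_fst.prodMk (continuous_snd.prodMk (f.symm.continuous.comp hF.continuous))
    have hten : Filter.Tendsto (fun p : ℝ × S₁ => (p.1, p.2, f.symm (F p.1 p.2))) (𝓝 (0, x))
        (𝓝 (0, x, x)) := by
      have := hc.tendsto ((0 : ℝ), x)
      simpa [h0] using this
    filter_upwards [hten.eventually (hloc x)] with p hp y hy hxy
    rw [hoff _ y hy] at hxy
    have hy2 : f.symm (F p.1 p.2) = y := by rw [hxy]; simp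
    rw [hy2] at hp
    refine hp ?_
    rw [hxy, hoff _ y hy]
  filter_upwards [hdet, hinj1, hinj2] with t hd h1 h2
  have hs := contMDiff_slice hF t
  have hd' : ∀ x, (dmap (F t) x).det ≠ 0 := by
    intro x
    by_cases hx : x ∈ K
    · rw [det_dmap]
      intro h
      refine hd x hx ?_
      rwa [sub_eq_zero, sq_eq_sq₀ (norm_nonneg _) (norm_nonneg _)] at h
    · rw [dmap_congr (eventuallyEq_of_notMem hK (hoff t) hx)]
      exact f.det_ne_zero x
  have hinj : Function.Injective (F t) := by
    intro x y hxy
    by_cases hx : x ∈ K <;> by_cases hy : y ∈ K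
    · exact h1 (x, y) ⟨hx, hy⟩ hxy
    · exact h2 x hx y hy hxy
    · exact (h2 y hy x hx hxy.symm).symm
    · rw [hoff t x hx, hoff t y hy] at hxy
      exact f.injective hxy
  -- The range is open, and it is closed as the union of the compact `F t '' K` and the image of a
  -- closed set under the homeomorphism `f`; connectedness of `S₂` finishes.
  have hsurj : Function.Surjective (F t) := by
    have hcl : ∀ x ∈ closure Kᶜ, F t x = f x := by
      have h : Set.EqOn (F t) f Kᶜ := fun x hx => hoff t x hx
      exact h.closure hs.continuous f.continuous
    have hr : Set.range (F t) = F t '' K ∪ f '' closure Kᶜ := by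
      ext y
      constructor
      · rintro ⟨x, rfl⟩
        by_cases hx : x ∈ K
        · exact Or.inl ⟨x, hx, rfl⟩
        · exact Or.inr ⟨x, subset_closure hx, (hoff t x hx).symm⟩
      · rintro (⟨x, -, rfl⟩ | ⟨x, hx, rfl⟩)
        · exact ⟨x, rfl⟩
        · exact ⟨x, hcl x hx⟩
    have hclosed : IsClosed (Set.range (F t)) := by
      rw [hr]
      exact (hK.image hs.continuous).isClosed.union
        (f.toHomeomorph.isClosedMap _ isClosed_closure)
    have hopen : IsOpen (Set.range (F t)) := (isOpenMap_of_det_ne_zero hs hd').isOpen_range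
    exact Set.range_eq_univ.1 (IsClopen.eq_univ ⟨hclosed, hopen⟩ (Set.range_nonempty _))
  exact exists_diffeo_of_bijective hs hd' ⟨hinj, hsurj⟩

/-- A diffeomorphism of a connected surface preserves or reverses the orientation. -/
theorem Diffeo.orientation [ConnectedSpace S₁] (σ : ConformalMetric S₁) (ρ : ConformalMetric S₂)
    (f : Diffeo S₁ S₂) : (∀ x, ‖dzbar f x‖ < ‖dz f x‖) ∨ (∀ x, ‖dz f x‖ < ‖dzbar f x‖) := by
  have hne : ∀ x, ‖dzbar f x‖ ≠ ‖dz f x‖ := by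
    intro x h
    have := f.det_ne_zero x
    rw [det_dmap, h] at this
    simp at this
  have hfam := contMDiff_const_family f.contMDiff_toFun
  have hopen : ∀ P : ℝ → ℝ → Prop, IsOpen {p : ℝ × ℝ | P p.1 p.2} →
      (∀ r u v, 0 < r → (P (r * u) (r * v) ↔ P u v)) → IsOpen {x | P ‖dz f x‖ ‖dzbar f x‖} := by
    intro P h1 h2
    rw [isOpen_iff_eventually]
    intro x hx
    have h := eventually_norm_dz_dzbar σ ρ h1 h2 (F := fun _ : ℝ => ⇑f) hfam (t := 0) hx
    have hc : Continuous (fun y : S₁ => ((0 : ℝ), y)) := by fun_prop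
    exact (hc.tendsto x).eventually h
  have o1 : IsOpen {x | ‖dzbar f x‖ < ‖dz f x‖} :=
    hopen (fun u v => v < u) (isOpen_lt continuous_snd continuous_fst)
      (fun r u v hr => mul_lt_mul_iff_right₀ hr)
  have o2 : IsOpen {x | ‖dz f x‖ < ‖dzbar f x‖} :=
    hopen (fun u v => u < v) (isOpen_lt continuous_fst continuous_snd)
      (fun r u v hr => mul_lt_mul_iff_right₀ hr)
  have hc : {x | ‖dzbar f x‖ < ‖dz f x‖}ᶜ = {x | ‖dz f x‖ < ‖dzbar f x‖} := by
    ext x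
    simp only [Set.mem_compl_iff, Set.mem_ofPred_eq, not_lt]
    exact ⟨fun h => lt_of_le_of_ne h (hne x).symm, le_of_lt⟩
  have hclopen : IsClopen {x | ‖dzbar f x‖ < ‖dz f x‖} :=
    ⟨isOpen_compl_iff.1 (hc ▸ o2), o1⟩
  rcases isClopen_iff.1 hclopen with h | h
  · right
    intro x
    have : x ∈ {x | ‖dzbar f x‖ < ‖dz f x‖}ᶜ := by rw [h]; simp
    rwa [hc] at this
  · left
    intro x
    have : x ∈ {x | ‖dzbar f x‖ < ‖dz f x‖} := by rw [h]; trivial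
    exact this

/-- Open scaling invariant conditions on `|f_z|` and `|f_z̄|` persist, for small times, along a
compactly supported variation. -/
theorem eventually_norm_dz_dzbar_of_forall [T2Space S₁] (σ : ConformalMetric S₁)
    (ρ : ConformalMetric S₂) {P : ℝ → ℝ → Prop} (hopen : IsOpen {p : ℝ × ℝ | P p.1 p.2})
    (hscale : ∀ r u v, 0 < r → (P (r * u) (r * v) ↔ P u v))
    {f : S₁ → S₂} {K : Set S₁} {F : ℝ → S₁ → S₂} (hK : IsCompact K)
    (hF : ContMDiff (𝓘(ℝ, ℝ).prod 𝓘(ℝ, ℂ)) 𝓘(ℝ, ℂ) ∞ (fun p : ℝ × S₁ => F p.1 p.2))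
    (h0 : F 0 = f) (hoff : ∀ t, ∀ x ∉ K, F t x = f x) (hP : ∀ x, P ‖dz f x‖ ‖dzbar f x‖) :
    ∀ᶠ t in 𝓝 (0 : ℝ), ∀ x, P ‖dz (F t) x‖ ‖dzbar (F t) x‖ := by
  have h : ∀ᶠ t in 𝓝 (0 : ℝ), ∀ x ∈ K, P ‖dz (F t) x‖ ‖dzbar (F t) x‖ := by
    refine hK.eventually_forall_of_forall_eventually fun x _ => ?_
    exact eventually_norm_dz_dzbar σ ρ hopen hscale hF (by rw [h0]; exact hP x)
  filter_upwards [h] with t ht x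
  by_cases hx : x ∈ K
  · exact ht x hx
  · have := dmap_congr (eventuallyEq_of_notMem hK (hoff t) hx)
    rw [dz, dzbar, this]
    exact hP x

/-- Raising `k` to the midpoint `(1 + k)/2` makes the condition strict, hence open. Strictness for
`f` needs `f_z ≠ 0`: otherwise `f_z̄` vanishes too and the derivative is singular. -/
theorem IsQuasiconformal.eventually [T2Space S₁] (σ : ConformalMetric S₁) (ρ : ConformalMetric S₂)
    {f : Diffeo S₁ S₂} (hf : IsQuasiconformal f) {K : Set S₁} {F : ℝ → S₁ → S₂} (hK : IsCompact K)
    (hF : ContMDiff (𝓘(ℝ, ℝ).prod 𝓘(ℝ, ℂ)) 𝓘(ℝ, ℂ) ∞ (fun p : ℝ × S₁ => F p.1 p.2))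
    (h0 : F 0 = f) (hoff : ∀ t, ∀ x ∉ K, F t x = f x) :
    ∀ᶠ t in 𝓝 (0 : ℝ), IsQuasiconformal (F t) := by
  obtain ⟨k, hk, hb⟩ := hf
  have h := eventually_norm_dz_dzbar_of_forall σ ρ (P := fun u v => v < (1 + k) / 2 * u)
    (isOpen_lt continuous_snd (by fun_prop)) (fun r u v hr => by
      rw [show (1 + k) / 2 * (r * u) = r * ((1 + k) / 2 * u) by ring]
      exact mul_lt_mul_iff_right₀ hr) hK hF h0 hoff (fun x => by
      have hpos : 0 < ‖dz f x‖ := by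
        refine lt_of_le_of_ne (norm_nonneg _) fun h => f.det_ne_zero x ?_
        have h2 := hb x
        rw [← h, mul_zero] at h2
        rw [det_dmap, ← h, le_antisymm h2 (norm_nonneg _), sub_self]
      refine (hb x).trans_lt ?_
      nlinarith)
  filter_upwards [h] with t ht
  exact ⟨(1 + k) / 2, by linarith, fun x => (ht x).le⟩

end

/-! ### Finiteness and differentiability of the energy over a compact set -/

theorem contDiff_linPart : ContDiff ℝ ∞ linPart := by
  have h : ∀ u : ℂ, ContDiff ℝ ∞ (fun L : ℂ →L[ℝ] ℂ => L u) := fun u =>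
    (ContinuousLinearMap.apply ℝ ℂ u).contDiff
  exact ((h 1).sub (contDiff_const.mul (h Complex.I))).div_const 2

theorem contDiff_antiPart : ContDiff ℝ ∞ antiPart := by
  have h : ∀ u : ℂ, ContDiff ℝ ∞ (fun L : ℂ →L[ℝ] ℂ => L u) := fun u =>
    (ContinuousLinearMap.apply ℝ ℂ u).contDiff
  exact ((h 1).add (contDiff_const.mul (h Complex.I))).div_const 2

section

variable {S : Type*} [TopologicalSpace S] [ChartedSpace ℂ S]
  [IsManifold 𝓘(ℂ) ω S] [MeasurableSpace S] [BorelSpace S]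

/-- The chart carries the local area to a measure absolutely continuous with respect to Lebesgue
measure, so null sets of the coefficient cause no trouble. -/
theorem BeltramiDifferential.aemeasurable_comp_chart [SecondCountableTopology S] [Nonempty S]
    (μ : BeltramiDifferential S) (σ : ConformalMetric S)
    {c : OpenPartialHomeomorph S ℂ} (hc : c ∈ atlas ℂ S) :
    AEMeasurable (fun x => μ.coeff c (c x)) (σ.localArea c) := by
  have h1 : AEMeasurable c (σ.localArea c) := by
    rw [← σ.area_restrict hc]
    exact c.continuousOn.aemeasurable c.open_source.measurableSet
  have h2 : Measure.map c (σ.localArea c) =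
      (volume.restrict c.target).withDensity fun z => ENNReal.ofReal (σ.coeff c z) := by
    rw [ConformalMetric.localArea] at h1 ⊢
    rw [AEMeasurable.map_map_of_aemeasurable h1 (aemeasurable_chart_symm c _)]
    conv_rhs => rw [← Measure.map_id (μ := (volume.restrict c.target).withDensity _)]
    refine Measure.map_congr ((withDensity_absolutelyContinuous _ _).ae_le ?_)
    filter_upwards [ae_restrict_mem c.open_target.measurableSet] with z hz
    simp [c.right_inv hz]
  refine AEMeasurable.comp_aemeasurable (g := μ.coeff c) ?_ h1
  rw [h2]
  exact (μ.aemeasurable c hc).mono_ac (withDensity_absolutelyContinuous _ _)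

theorem ConformalMetric.area_lt_top_of_isCompact [SecondCountableTopology S] [Nonempty S]
    (σ : ConformalMetric S) {K : Set S} (hK : IsCompact K) : σ.toRMetric.area K < ⊤ := by
  refine hK.measure_lt_top_of_nhdsWithin fun x _ => ?_
  refine Measure.FiniteAtFilter.filter_mono nhdsWithin_le_nhds ?_
  set c := chartAt ℂ x
  have hxa : x ∈ c.source := mem_chart_source ℂ x
  have hc := chart_mem_atlas ℂ x
  have hσ : ContinuousAt (σ.coeff c) (c x) :=
    (σ.smooth c hc).continuousOn.continuousAt (c.open_target.mem_nhds (c.map_source hxa))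
  have n1 : ∀ᶠ z in 𝓝 (c x), σ.coeff c z < σ.coeff c (c x) + 1 :=
    hσ.eventually_lt_const (by linarith)
  have n2 : ∀ᶠ z in 𝓝 (c x), z ∈ Metric.ball (c x) 1 := Metric.ball_mem_nhds _ one_pos
  obtain ⟨V, hV, hVo, hxV⟩ := eventually_nhds_iff.1 (n1.and n2)
  have hU : IsOpen (c.source ∩ c ⁻¹' V) := c.isOpen_inter_preimage hVo
  refine ⟨c.source ∩ c ⁻¹' V, hU.mem_nhds ⟨hxa, hxV⟩, ?_⟩
  have e : σ.toRMetric.area (c.source ∩ c ⁻¹' V) = σ.localArea c (c.source ∩ c ⁻¹' V) := by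
    rw [← σ.area_restrict hc, Measure.restrict_apply hU.measurableSet,
      Set.inter_eq_left.2 Set.inter_subset_left]
  rw [e, σ.localArea_apply c hU.measurableSet]
  calc ∫⁻ z in c.target ∩ c.symm ⁻¹' (c.source ∩ c ⁻¹' V), ENNReal.ofReal (σ.coeff c z)
      ≤ ∫⁻ z in c.target ∩ c.symm ⁻¹' (c.source ∩ c ⁻¹' V),
          ENNReal.ofReal (σ.coeff c (c x) + 1) := by
        refine setLIntegral_mono' (measurableSet_chart_preimage c hU.measurableSet) ?_
        rintro z ⟨hz, -, hzV⟩
        refine ENNReal.ofReal_le_ofReal ?_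
        rw [Set.mem_preimage, c.right_inv hz] at hzV
        exact (hV z hzV).1.le
    _ = ENNReal.ofReal (σ.coeff c (c x) + 1) *
          volume (c.target ∩ c.symm ⁻¹' (c.source ∩ c ⁻¹' V)) := setLIntegral_const _ _
    _ ≤ ENNReal.ofReal (σ.coeff c (c x) + 1) * volume (Metric.ball (c x) 1) := by
        gcongr
        rintro z ⟨hz, -, hzV⟩
        rw [Set.mem_preimage, c.right_inv hz] at hzV
        exact (hV z hzV).2
    _ < ⊤ := ENNReal.mul_lt_top ENNReal.ofReal_lt_top measure_ball_lt_top

end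

section

variable {S₁ : Type*} [TopologicalSpace S₁] [ChartedSpace ℂ S₁]
  {S₂ : Type*} [TopologicalSpace S₂] [ChartedSpace ℂ S₂]

theorem normSqDf_nonneg (σ : ConformalMetric S₁) (μ : BeltramiDifferential S₁)
    (ρ : ConformalMetric S₂) (f : S₁ → S₂) (x : S₁) : 0 ≤ normSqDf (gMetric σ μ) ρ f x := by
  rw [normSqDf_eq]
  have h1 := (σ.at_pos x).le
  have h2 := (ρ.at_pos (f x)).le
  positivity

variable [IsManifold 𝓘(ℂ) ω S₁] [IsManifold 𝓘(ℂ) ω S₂]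

/-- In charts the energy density of a smooth family is `P + Re (μ Q)` with `P`, `Q` smooth. -/
theorem exists_energyDensity_rep (σ : ConformalMetric S₁) (μ : BeltramiDifferential S₁)
    (ρ : ConformalMetric S₂) {k : ℝ} (hμ : ∀ c ∈ atlas ℂ S₁, ∀ z ∈ c.target, ‖μ.coeff c z‖ = k)
    (hk : k ^ 2 < 1) {F : ℝ → S₁ → S₂}
    (hF : ContMDiff (𝓘(ℝ, ℝ).prod 𝓘(ℝ, ℂ)) 𝓘(ℝ, ℂ) ∞ (fun p : ℝ × S₁ => F p.1 p.2))
    {c : OpenPartialHomeomorph S₁ ℂ} {c' : OpenPartialHomeomorph S₂ ℂ}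
    (hc : c ∈ atlas ℂ S₁) (hc' : c' ∈ atlas ℂ S₂) :
    ∃ (P : ℝ × ℂ → ℝ) (Q : ℝ × ℂ → ℂ), ContDiffOn ℝ ∞ P (familyDomain c c' F) ∧
      ContDiffOn ℝ ∞ Q (familyDomain c c' F) ∧
      ∀ t, ∀ x ∈ c.source, F t x ∈ c'.source →
        1 / 2 * normSqDf (gMetric σ μ) ρ (F t) x = P (t, c x) + (μ.coeff c (c x) * Q (t, c x)).re := by
  have hrep := contDiffOn_familyRep hc hc' hF
  have hder := contDiffOn_familyDeriv hc hc' hF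
  have hB := contDiff_linPart.comp_contDiffOn hder
  have hA := contDiff_antiPart.comp_contDiffOn hder
  have hρ : ContDiffOn ℝ ∞ (ρ.coeff c' ∘ familyRep c c' F) (familyDomain c c' F) :=
    (ρ.smooth c' hc').comp hrep fun p hp => c'.map_source hp.2
  have hσ : ContDiffOn ℝ ∞ (σ.coeff c ∘ Prod.snd) (familyDomain c c' F) :=
    (σ.smooth c hc).comp contDiffOn_snd fun p hp => hp.1
  have hk' : (1 - k ^ 2) ^ 2 ≠ 0 := pow_ne_zero _ (by linarith)
  have hfac : ContDiffOn ℝ ∞ (fun p => ρ.coeff c' (familyRep c c' F p) /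
      (σ.coeff c p.2 * (1 - k ^ 2) ^ 2)) (familyDomain c c' F) :=
    hρ.div (hσ.mul contDiffOn_const) fun p hp => mul_ne_zero (σ.pos c hc _ hp.1).ne' hk'
  -- Since `|μ| = k`, the quadratic term in `μ` is constant and belongs to the smooth `P`; the
  -- factor `-4` in `Q` comes from the cross terms.
  refine ⟨fun p => ρ.coeff c' (familyRep c c' F p) / (σ.coeff c p.2 * (1 - k ^ 2) ^ 2) *
      ((1 + k ^ 2) * (‖antiPart (familyDeriv c c' F p)‖ ^ 2 + ‖linPart (familyDeriv c c' F p)‖ ^ 2)),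
    fun p => ((ρ.coeff c' (familyRep c c' F p) / (σ.coeff c p.2 * (1 - k ^ 2) ^ 2) : ℝ) : ℂ) *
      (-4 * (linPart (familyDeriv c c' F p) * starRingEnd ℂ (antiPart (familyDeriv c c' F p)))),
    ?_, ?_, ?_⟩
  · exact hfac.mul (contDiffOn_const.mul ((hA.norm_sq ℝ).add (hB.norm_sq ℝ)))
  · exact (Complex.ofRealCLM.contDiff.comp_contDiffOn hfac).mul (contDiffOn_const.mul
      (hB.mul (Complex.conjCLE.contDiff.comp_contDiffOn hA)))
  · intro t x hx hx'
    rw [normSqDf_eq_chart σ μ ρ hμ hc hc' (contMDiff_slice hF t).contMDiffAt hx hx',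
      chartDeriv_eq_familyDeriv hc hc' hF hx hx']
    have e : familyRep c c' F (t, c x) = c' (F t x) := by simp [familyRep, c.left_inv hx]
    simp only [e]
    generalize ρ.coeff c' (c' (F t x)) / (σ.coeff c (c x) * (1 - k ^ 2) ^ 2) = r
    rw [show ∀ m B A : ℂ, m * ((r : ℂ) * (-4 * (B * A))) = ((-4 * r : ℝ) : ℂ) * (m * (B * A)) by
      intro m B A; push_cast; ring, Complex.re_ofReal_mul]
    ring

theorem aemeasurable_energyDensity [SecondCountableTopology S₁] [Nonempty S₁]
    [MeasurableSpace S₁] [BorelSpace S₁] (σ : ConformalMetric S₁) (μ : BeltramiDifferential S₁)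
    (ρ : ConformalMetric S₂) {k : ℝ} (hμ : ∀ c ∈ atlas ℂ S₁, ∀ z ∈ c.target, ‖μ.coeff c z‖ = k)
    (hk : k ^ 2 < 1) {f : S₁ → S₂} (hf : ContMDiff 𝓘(ℝ, ℂ) 𝓘(ℝ, ℂ) ∞ f) :
    AEMeasurable (fun x => 1 / 2 * normSqDf (gMetric σ μ) ρ f x) σ.toRMetric.area := by
  obtain ⟨s, hs, hcov⟩ := exists_countable_iUnion_nhds
    (fun x : S₁ => (chartAt ℂ x).source ∩ f ⁻¹' (chartAt ℂ (f x)).source)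
    (fun x => Filter.inter_mem ((chartAt ℂ x).open_source.mem_nhds (mem_chart_source ℂ x))
      (hf.continuous.continuousAt.eventually_mem
        ((chartAt ℂ (f x)).open_source.mem_nhds (mem_chart_source ℂ (f x)))))
  have := hs.to_subtype
  rw [← Measure.restrict_univ (μ := σ.toRMetric.area), ← hcov, aemeasurable_iUnion_iff]
  rintro ⟨x, hx⟩
  have hc := chart_mem_atlas ℂ x
  have hc' := chart_mem_atlas ℂ (f x)
  set c := chartAt ℂ x
  set c' := chartAt ℂ (f x)
  have hU : IsOpen (c.source ∩ f ⁻¹' c'.source) :=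
    c.open_source.inter (c'.open_source.preimage hf.continuous)
  obtain ⟨P, Q, hP, hQ, hrep⟩ := exists_energyDensity_rep σ μ ρ hμ hk (F := fun _ => f)
    (contMDiff_const_family hf) hc hc'
  have hmaps : Set.MapsTo (fun y => ((0 : ℝ), c y)) (c.source ∩ f ⁻¹' c'.source)
      (familyDomain c c' fun _ => f) := fun y hy => mem_familyDomain hy.1 hy.2
  have hcc : ContinuousOn (fun y => ((0 : ℝ), c y)) (c.source ∩ f ⁻¹' c'.source) :=
    continuousOn_const.prodMk (c.continuousOn.mono Set.inter_subset_left)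
  have m1 := (hP.continuousOn.comp hcc hmaps).aemeasurable (μ := σ.toRMetric.area) hU.measurableSet
  have m2 := (hQ.continuousOn.comp hcc hmaps).aemeasurable (μ := σ.toRMetric.area) hU.measurableSet
  have m3 : AEMeasurable (fun y => μ.coeff c (c y))
      (σ.toRMetric.area.restrict (c.source ∩ f ⁻¹' c'.source)) := by
    have := μ.aemeasurable_comp_chart σ hc
    rw [← σ.area_restrict hc] at this
    exact this.mono_measure (Measure.restrict_mono Set.inter_subset_left le_rfl)
  refine (m1.add (Complex.measurable_re.comp_aemeasurable (m3.mul m2))).congr ?_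
  filter_upwards [ae_restrict_mem hU.measurableSet] with y hy
  exact (hrep 0 y hy.1 hy.2).symm

/-- The energy density of a smooth family is differentiable in time, with locally bounded
derivative. -/
theorem exists_energyDensity_bound (σ : ConformalMetric S₁) (μ : BeltramiDifferential S₁)
    (ρ : ConformalMetric S₂) {k : ℝ} (hμ : ∀ c ∈ atlas ℂ S₁, ∀ z ∈ c.target, ‖μ.coeff c z‖ = k)
    (hk : k ^ 2 < 1) {F : ℝ → S₁ → S₂}
    (hF : ContMDiff (𝓘(ℝ, ℝ).prod 𝓘(ℝ, ℂ)) 𝓘(ℝ, ℂ) ∞ (fun p : ℝ × S₁ => F p.1 p.2))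
    (t₀ : ℝ) (x₀ : S₁) :
    ∃ C, ∀ᶠ p : ℝ × S₁ in 𝓝 (t₀, x₀),
      DifferentiableAt ℝ (fun s => 1 / 2 * normSqDf (gMetric σ μ) ρ (F s) p.2) p.1 ∧
      |1 / 2 * normSqDf (gMetric σ μ) ρ (F p.1) p.2| ≤ C ∧
      |deriv (fun s => 1 / 2 * normSqDf (gMetric σ μ) ρ (F s) p.2) p.1| ≤ C := by
  have hc := chart_mem_atlas ℂ x₀
  have hc' := chart_mem_atlas ℂ (F t₀ x₀)
  have hxa := mem_chart_source ℂ x₀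
  have hxb := mem_chart_source ℂ (F t₀ x₀)
  set c := chartAt ℂ x₀
  set c' := chartAt ℂ (F t₀ x₀)
  obtain ⟨P, Q, hP, hQ, hrep⟩ := exists_energyDensity_rep σ μ ρ hμ hk hF hc hc'
  have hW : IsOpen (familyDomain c c' F) := isOpen_familyDomain hF.continuous
  have hp0 := mem_familyDomain (t := t₀) hxa hxb
  have cP := hP.continuousOn.continuousAt (hW.mem_nhds hp0)
  have cQ := hQ.continuousOn.continuousAt (hW.mem_nhds hp0)
  have cdP := (hP.continuousOn_fderiv_of_isOpen hW (by simp)).continuousAt (hW.mem_nhds hp0)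
  have cdQ := (hQ.continuousOn_fderiv_of_isOpen hW (by simp)).continuousAt (hW.mem_nhds hp0)
  have aP : ContinuousAt (fun q => fderiv ℝ P q (1, 0)) (t₀, c x₀) := cdP.clm_apply continuousAt_const
  have aQ : ContinuousAt (fun q => fderiv ℝ Q q (1, 0)) (t₀, c x₀) := cdQ.clm_apply continuousAt_const
  -- A continuous majorant of both the density and its time derivative: `μ` may be discontinuous,
  -- but its modulus is `k`.
  have hb : ContinuousAt (fun q => |P q| + |k| * ‖Q q‖ + (|fderiv ℝ P q (1, 0)| +
      |k| * ‖fderiv ℝ Q q (1, 0)‖)) (t₀, c x₀) :=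
    (cP.abs.add (continuousAt_const.mul cQ.norm)).add (aP.abs.add (continuousAt_const.mul aQ.norm))
  obtain ⟨M, hb1⟩ : ∃ M, ∀ᶠ q in 𝓝 (t₀, c x₀), |P q| + |k| * ‖Q q‖ + (|fderiv ℝ P q (1, 0)| +
      |k| * ‖fderiv ℝ Q q (1, 0)‖) < M := ⟨_, hb.eventually_lt_const (lt_add_one _)⟩
  refine ⟨M, ?_⟩
  · have hten : Filter.Tendsto (fun p : ℝ × S₁ => (p.1, c p.2)) (𝓝 (t₀, x₀)) (𝓝 (t₀, c x₀)) :=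
      continuousAt_fst.prodMk
        (ContinuousAt.comp (f := Prod.snd) (g := c) (c.continuousAt hxa) continuousAt_snd)
    have n1 : ∀ᶠ p : ℝ × S₁ in 𝓝 (t₀, x₀), p.2 ∈ c.source :=
      continuousAt_snd.eventually_mem (c.open_source.mem_nhds hxa)
    have n2 : ∀ᶠ p : ℝ × S₁ in 𝓝 (t₀, x₀), F p.1 p.2 ∈ c'.source :=
      hF.continuous.continuousAt.eventually_mem (c'.open_source.mem_nhds hxb)
    filter_upwards [hten.eventually hb1, n1, n2] with ⟨t, x⟩ h0 h1 h2
    simp only at h0 h1 h2 ⊢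
    have hk1 : ‖μ.coeff c (c x)‖ ≤ |k| := by
      rw [hμ c hc _ (c.map_source h1)]; exact le_abs_self k
    have hpt := mem_familyDomain (t := t) h1 h2
    have dP := ((hP.contDiffAt (hW.mem_nhds hpt)).differentiableAt (by simp)).hasFDerivAt
    have dQ := ((hQ.contDiffAt (hW.mem_nhds hpt)).differentiableAt (by simp)).hasFDerivAt
    have hline : HasDerivAt (fun s : ℝ => (s, c x)) ((1 : ℝ), (0 : ℂ)) t :=
      (hasDerivAt_id t).prodMk (hasDerivAt_const t (c x))
    have dP' : HasDerivAt (fun s => P (s, c x)) (fderiv ℝ P (t, c x) (1, 0)) t :=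
      dP.comp_hasDerivAt t hline
    have dQ' : HasDerivAt (fun s => Q (s, c x)) (fderiv ℝ Q (t, c x) (1, 0)) t :=
      dQ.comp_hasDerivAt t hline
    have dre : HasDerivAt (fun s => (μ.coeff c (c x) * Q (s, c x)).re)
        (μ.coeff c (c x) * fderiv ℝ Q (t, c x) (1, 0)).re t :=
      Complex.reCLM.hasFDerivAt.comp_hasDerivAt t (dQ'.const_mul (μ.coeff c (c x)))
    have hslice : ∀ᶠ s in 𝓝 t, F s x ∈ c'.source := by
      have hcs : Continuous (fun s => F s x) :=
        hF.continuous.comp (f := fun s : ℝ => (s, x)) (by fun_prop)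
      exact hcs.continuousAt.eventually_mem (c'.open_source.mem_nhds h2)
    have hd := (dP'.add dre).congr_of_eventuallyEq
      (f₁ := fun s => 1 / 2 * normSqDf (gMetric σ μ) ρ (F s) x) (by
        filter_upwards [hslice] with s hs using hrep s x h1 hs)
    have b1 : ∀ q : ℂ, |(μ.coeff c (c x) * q).re| ≤ |k| * ‖q‖ := fun q =>
      (Complex.abs_re_le_norm _).trans (by rw [norm_mul]; gcongr)
    have p1 := abs_nonneg (P (t, c x))
    have p2 := mul_nonneg (abs_nonneg k) (norm_nonneg (Q (t, c x)))
    have p3 := abs_nonneg (fderiv ℝ P (t, c x) (1, 0))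
    have p4 := mul_nonneg (abs_nonneg k) (norm_nonneg (fderiv ℝ Q (t, c x) (1, 0)))
    refine ⟨hd.differentiableAt, ?_, ?_⟩
    · rw [hrep t x h1 h2]
      have := b1 (Q (t, c x))
      exact (abs_add_le _ _).trans (by linarith)
    · rw [hd.deriv]
      have := b1 (fderiv ℝ Q (t, c x) (1, 0))
      exact (abs_add_le _ _).trans (by linarith)

/-- Compactness turns the local bounds into one constant and one time neighbourhood valid on all of
`K`, as dominated differentiation requires. -/
theorem exists_energyDensity_bound_of_isCompact (σ : ConformalMetric S₁)
    (μ : BeltramiDifferential S₁) (ρ : ConformalMetric S₂) {k : ℝ}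
    (hμ : ∀ c ∈ atlas ℂ S₁, ∀ z ∈ c.target, ‖μ.coeff c z‖ = k)
    (hk : k ^ 2 < 1) {F : ℝ → S₁ → S₂}
    (hF : ContMDiff (𝓘(ℝ, ℝ).prod 𝓘(ℝ, ℂ)) 𝓘(ℝ, ℂ) ∞ (fun p : ℝ × S₁ => F p.1 p.2))
    {K : Set S₁} (hK : IsCompact K) (t₀ : ℝ) :
    ∃ C, ∀ᶠ t in 𝓝 t₀, ∀ x ∈ K,
      DifferentiableAt ℝ (fun s => 1 / 2 * normSqDf (gMetric σ μ) ρ (F s) x) t ∧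
      |1 / 2 * normSqDf (gMetric σ μ) ρ (F t) x| ≤ C ∧
      |deriv (fun s => 1 / 2 * normSqDf (gMetric σ μ) ρ (F s) x) t| ≤ C := by
  refine hK.induction_on ?_ ?_ ?_ ?_
  · exact ⟨0, by simp⟩
  · rintro s u hsu ⟨C, hC⟩
    exact ⟨C, hC.mono fun t ht x hx => ht x (hsu hx)⟩
  · rintro s u ⟨C, hC⟩ ⟨D, hD⟩
    refine ⟨max C D, ?_⟩
    filter_upwards [hC, hD] with t h1 h2 x hx
    rcases hx with hx | hx
    · obtain ⟨a, b, d⟩ := h1 x hx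
      exact ⟨a, b.trans (le_max_left _ _), d.trans (le_max_left _ _)⟩
    · obtain ⟨a, b, d⟩ := h2 x hx
      exact ⟨a, b.trans (le_max_right _ _), d.trans (le_max_right _ _)⟩
  · intro x _
    obtain ⟨C, hC⟩ := exists_energyDensity_bound σ μ ρ hμ hk hF t₀ x
    rw [nhds_prod_eq, Filter.eventually_prod_iff] at hC
    obtain ⟨pa, ha, pb, hb, h⟩ := hC
    exact ⟨{y | pb y}, nhdsWithin_le_nhds hb, C, ha.mono fun t ht y hy => h ht hy⟩

/-- The energy over a compact set is finite along a smooth family, and differentiable in time. -/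
theorem harmonicEnergyOn_family [SecondCountableTopology S₁] [Nonempty S₁] [T2Space S₁]
    [MeasurableSpace S₁] [BorelSpace S₁] (σ : ConformalMetric S₁) (μ : BeltramiDifferential S₁)
    (ρ : ConformalMetric S₂) {k : ℝ} (hμ : ∀ c ∈ atlas ℂ S₁, ∀ z ∈ c.target, ‖μ.coeff c z‖ = k)
    (hk : k ^ 2 < 1) {F : ℝ → S₁ → S₂}
    (hF : ContMDiff (𝓘(ℝ, ℝ).prod 𝓘(ℝ, ℂ)) 𝓘(ℝ, ℂ) ∞ (fun p : ℝ × S₁ => F p.1 p.2))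
    {K : Set S₁} (hK : IsCompact K) :
    (∀ t, harmonicEnergyOn (gMetric σ μ) ρ K (F t) ≠ ⊤) ∧
      ∃ d, HasDerivAt (fun t => (harmonicEnergyOn (gMetric σ μ) ρ K (F t)).toReal) d 0 := by
  set e : ℝ → S₁ → ℝ := fun t x => 1 / 2 * normSqDf (gMetric σ μ) ρ (F t) x with he
  set ν := (gMetric σ μ).area.restrict K with hν
  have harea := gMetric_area σ μ hk.le hμ
  have hfin : IsFiniteMeasure ν := by
    refine ⟨?_⟩
    rw [hν, Measure.restrict_apply_univ, harea, Measure.smul_apply, smul_eq_mul]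
    exact ENNReal.mul_lt_top ENNReal.ofReal_lt_top (σ.area_lt_top_of_isCompact hK)
  have hmeas : ∀ t, AEMeasurable (e t) ν := by
    intro t
    have h := aemeasurable_energyDensity σ μ ρ hμ hk (contMDiff_slice hF t)
    refine h.mono_ac (Measure.restrict_le_self.absolutelyContinuous.trans ?_)
    rw [harea]
    exact Measure.smul_absolutelyContinuous
  have hnn : ∀ t x, 0 ≤ e t x := fun t x => mul_nonneg (by norm_num) (normSqDf_nonneg σ μ ρ _ _)
  have hmem : ∀ᵐ x ∂ν, x ∈ K := ae_restrict_mem hK.isClosed.measurableSet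
  have hint : ∀ t, Integrable (e t) ν := by
    intro t
    obtain ⟨C, hC⟩ := exists_energyDensity_bound_of_isCompact σ μ ρ hμ hk hF hK t
    refine Integrable.of_bound (hmeas t).aestronglyMeasurable C ?_
    filter_upwards [hmem] with x hx
    exact (hC.self_of_nhds x hx).2.1
  have heq : ∀ t, harmonicEnergyOn (gMetric σ μ) ρ K (F t) = ENNReal.ofReal (∫ x, e t x ∂ν) :=
    fun t => (ofReal_integral_eq_lintegral_ofReal (hint t)
      (Filter.Eventually.of_forall (hnn t))).symm
  refine ⟨fun t => by rw [heq]; exact ENNReal.ofReal_ne_top, ?_⟩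
  have heq2 : (fun t => (harmonicEnergyOn (gMetric σ μ) ρ K (F t)).toReal) =
      fun t => ∫ x, e t x ∂ν := by
    ext t
    rw [heq, ENNReal.toReal_ofReal (integral_nonneg (hnn t))]
  rw [heq2]
  obtain ⟨C, hC⟩ := exists_energyDensity_bound_of_isCompact σ μ ρ hμ hk hF hK 0
  refine ⟨_, (hasDerivAt_integral_of_dominated_loc_of_deriv_le
    (F' := fun t x => deriv (fun s => e s x) t) (bound := fun _ => C) hC
    (Filter.Eventually.of_forall fun t => (hmeas t).aestronglyMeasurable) (hint 0) ?_ ?_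
    (integrable_const C) ?_).2⟩
  -- The time derivative is measurable as an almost everywhere limit of difference quotients with
  -- steps `1/(n + 1)`.
  · refine AEMeasurable.aestronglyMeasurable ?_
    have hseq : Filter.Tendsto (fun n : ℕ => (1 : ℝ) / ((n : ℝ) + 1)) Filter.atTop (𝓝[≠] 0) := by
      refine tendsto_nhdsWithin_iff.2 ⟨tendsto_one_div_add_atTop_nhds_zero_nat, ?_⟩
      exact Filter.Eventually.of_forall fun n => (one_div_pos.2 (by positivity)).ne'
    refine aemeasurable_of_tendsto_metrizable_ae Filter.atTop
      (f := fun (n : ℕ) x => ((1 : ℝ) / ((n : ℝ) + 1))⁻¹ * (e (0 + 1 / ((n : ℝ) + 1)) x - e 0 x)) ?_ ?_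
    · intro n
      exact ((hmeas _).sub (hmeas 0)).const_mul _
    · filter_upwards [hmem] with x hx
      exact (hasDerivAt_iff_tendsto_slope_zero.1 (hC.self_of_nhds x hx).1.hasDerivAt).comp hseq
  · filter_upwards [hmem] with x hx t ht
    exact (ht x hx).2.2
  · filter_upwards [hmem] with x hx t ht
    exact (ht x hx).1.hasDerivAt

end

/-! ### Comparison of the two energies and the conclusion -/

section

variable {S₁ : Type*} [TopologicalSpace S₁] [ChartedSpace ℂ S₁]
  {S₂ : Type*} [TopologicalSpace S₂] [ChartedSpace ℂ S₂]

/-- The least squares Beltrami energy over a subset of the surface. -/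
noncomputable def lbsEnergyOn [MeasurableSpace S₁] (σ : ConformalMetric S₁) (ρ : ConformalMetric S₂)
    (μ : BeltramiDifferential S₁) (K : Set S₁) (f : S₁ → S₂) : ENNReal :=
  ∫⁻ x in K, ENNReal.ofReal (ρ.at (f x) / σ.at x * ‖dzbar f x - μ.at x * dz f x‖ ^ 2)
    ∂σ.toRMetric.area

theorem lintegral_const_mul_lbs [MeasurableSpace S₁] (σ : ConformalMetric S₁) (μ : BeltramiDifferential S₁)
    (ρ : ConformalMetric S₂) {a : ℝ} (ha : 0 ≤ a) (K : Set S₁) (f : S₁ → S₂) :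
    ENNReal.ofReal a * lbsEnergyOn σ ρ μ K f = ∫⁻ x in K, ENNReal.ofReal
      (a * (ρ.at (f x) / σ.at x * ‖dzbar f x - μ.at x * dz f x‖ ^ 2)) ∂σ.toRMetric.area := by
  rw [lbsEnergyOn, ← lintegral_const_mul' _ _ ENNReal.ofReal_ne_top]
  refine lintegral_congr fun x => ?_
  rw [ENNReal.ofReal_mul ha]

/-- The energies off `K` coincide and are finite, so they cancel from the global inequality. -/
theorem lbsEnergyOn_le_of_eq_off [T2Space S₁] [MeasurableSpace S₁] [BorelSpace S₁] (σ : ConformalMetric S₁)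
    (μ : BeltramiDifferential S₁) (ρ : ConformalMetric S₂) {f g : S₁ → S₂} {K : Set S₁}
    (hK : IsCompact K) (hoff : ∀ x ∉ K, g x = f x) (hfin : lbsEnergy σ ρ μ f ≠ ⊤)
    (hle : lbsEnergy σ ρ μ f ≤ lbsEnergy σ ρ μ g) :
    lbsEnergyOn σ ρ μ K f ≤ lbsEnergyOn σ ρ μ K g := by
  have hKm := hK.isClosed.measurableSet
  have hsplit : ∀ u : S₁ → S₂,
      lbsEnergyOn σ ρ μ K u + lbsEnergyOn σ ρ μ Kᶜ u = lbsEnergy σ ρ μ u :=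
    fun u => lintegral_add_compl _ hKm
  have hc : lbsEnergyOn σ ρ μ Kᶜ g = lbsEnergyOn σ ρ μ Kᶜ f := by
    refine setLIntegral_congr_fun hKm.compl fun x hx => ?_
    simp only [dz, dzbar, dmap_congr (eventuallyEq_of_notMem hK hoff hx), hoff x hx]
  rw [← hsplit f, ← hsplit g, hc] at hle
  refine (ENNReal.add_le_add_iff_right ?_).1 hle
  rw [← hsplit f] at hfin
  exact (ENNReal.add_ne_top.1 hfin).2

variable [IsManifold 𝓘(ℂ) ω S₁] [SecondCountableTopology S₁] [Nonempty S₁] [MeasurableSpace S₁]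
  [BorelSpace S₁]

theorem harmonicEnergyOn_eq_lintegral (σ : ConformalMetric S₁) (μ : BeltramiDifferential S₁)
    (ρ : ConformalMetric S₂) {k : ℝ} (hμ : ∀ c ∈ atlas ℂ S₁, ∀ z ∈ c.target, ‖μ.coeff c z‖ = k)
    (hk : k ^ 2 < 1) (K : Set S₁) (f : S₁ → S₂) :
    harmonicEnergyOn (gMetric σ μ) ρ K f = ∫⁻ x in K,
      ENNReal.ofReal ((1 - k ^ 2) * (1 / 2 * normSqDf (gMetric σ μ) ρ f x)) ∂σ.toRMetric.area := by
  rw [harmonicEnergyOn, gMetric_area σ μ hk.le hμ, Measure.restrict_smul, lintegral_smul_measure,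
    smul_eq_mul, ← lintegral_const_mul' _ _ ENNReal.ofReal_ne_top]
  refine lintegral_congr fun x => ?_
  rw [ENNReal.ofReal_mul (by linarith : 0 ≤ 1 - k ^ 2)]

variable [IsManifold 𝓘(ℂ) ω S₂]

/-- The signed Jacobian in `normSqDf_eq_lbs_add` is nonnegative here and equals `jacDensity`. -/
theorem harmonicEnergyOn_of_orientation_preserving (σ : ConformalMetric S₁)
    (μ : BeltramiDifferential S₁) (ρ : ConformalMetric S₂) {k : ℝ}
    (hμ : ∀ c ∈ atlas ℂ S₁, ∀ z ∈ c.target, ‖μ.coeff c z‖ = k) (hk : k ^ 2 < 1) (K : Set S₁)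
    {f : S₁ → S₂} (hf : ContMDiff 𝓘(ℝ, ℂ) 𝓘(ℝ, ℂ) ∞ f) (hor : ∀ x, ‖dzbar f x‖ < ‖dz f x‖) :
    harmonicEnergyOn (gMetric σ μ) ρ K f =
      ENNReal.ofReal (2 / (1 - k ^ 2)) * lbsEnergyOn σ ρ μ K f +
        ∫⁻ x in K, ENNReal.ofReal (jacDensity σ ρ f x) ∂σ.toRMetric.area := by
  have ha : 0 ≤ 2 / (1 - k ^ 2) := div_nonneg zero_le_two (by linarith)
  rw [lintegral_const_mul_lbs σ μ ρ ha, harmonicEnergyOn_eq_lintegral σ μ ρ hμ hk,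
    ← lintegral_add_right _ (continuous_jacDensity σ ρ hf).measurable.ennreal_ofReal]
  refine lintegral_congr fun x => ?_
  have h1 := (σ.at_pos x).le
  have h2 := (ρ.at_pos (f x)).le
  rw [← ENNReal.ofReal_add (by positivity) (jacDensity_nonneg σ ρ f x),
    normSqDf_eq_lbs_add σ μ ρ hμ, jacDensity, abs_of_nonneg]
  exact sub_nonneg.2 (pow_le_pow_left₀ (norm_nonneg _) (hor x).le 2)

/-- The signed Jacobian is now negative; moving it to the other side keeps every term in `ENNReal`.
-/
theorem harmonicEnergyOn_of_orientation_reversing (σ : ConformalMetric S₁)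
    (μ : BeltramiDifferential S₁) (ρ : ConformalMetric S₂) {k : ℝ}
    (hμ : ∀ c ∈ atlas ℂ S₁, ∀ z ∈ c.target, ‖μ.coeff c z‖ = k) (hk : k ^ 2 < 1) (K : Set S₁)
    {f : S₁ → S₂} (hf : ContMDiff 𝓘(ℝ, ℂ) 𝓘(ℝ, ℂ) ∞ f) (hor : ∀ x, ‖dz f x‖ < ‖dzbar f x‖) :
    harmonicEnergyOn (gMetric σ μ) ρ K f +
        ∫⁻ x in K, ENNReal.ofReal (jacDensity σ ρ f x) ∂σ.toRMetric.area =
      ENNReal.ofReal (2 / (1 - k ^ 2)) * lbsEnergyOn σ ρ μ K f := by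
  have ha : 0 ≤ 2 / (1 - k ^ 2) := div_nonneg zero_le_two (by linarith)
  rw [lintegral_const_mul_lbs σ μ ρ ha, harmonicEnergyOn_eq_lintegral σ μ ρ hμ hk,
    ← lintegral_add_right _ (continuous_jacDensity σ ρ hf).measurable.ennreal_ofReal]
  refine lintegral_congr fun x => ?_
  have hk' : 0 ≤ 1 - k ^ 2 := by linarith
  have hn := normSqDf_nonneg σ μ ρ f x
  rw [← ENNReal.ofReal_add (by positivity) (jacDensity_nonneg σ ρ f x),
    normSqDf_eq_lbs_add σ μ ρ hμ, jacDensity, abs_of_nonpos]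
  · congr 1
    ring
  · exact sub_nonpos.2 (pow_le_pow_left₀ (norm_nonneg _) (hor x).le 2)

/-- A minimizer of the least squares Beltrami energy in a class that contains all small compactly
supported variations is harmonic. -/
theorem IsLBS.isHarmonicMap [T2Space S₁] [ConnectedSpace S₁]
    [T2Space S₂] [SecondCountableTopology S₂] [ConnectedSpace S₂]
    {σ : ConformalMetric S₁} {ρ : ConformalMetric S₂} {μ : BeltramiDifferential S₁}
    (hμ : μ.HasConstantModulus) {𝒜 : Set (Diffeo S₁ S₂)} {f : Diffeo S₁ S₂}
    (hf : IsLBS σ ρ μ 𝒜 f)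
    (h𝒜 : ∀ (K : Set S₁) (F : ℝ → S₁ → S₂), IsCompact K →
      ContMDiff (𝓘(ℝ, ℝ).prod 𝓘(ℝ, ℂ)) 𝓘(ℝ, ℂ) ∞ (fun p : ℝ × S₁ => F p.1 p.2) →
      F 0 = f → (∀ t, ∀ x ∉ K, F t x = f x) →
      ∀ᶠ t in 𝓝 (0 : ℝ), ∀ g : Diffeo S₁ S₂, ⇑g = F t → g ∈ 𝒜) :
    IsHarmonicMap (gMetric σ μ) ρ f := by
  obtain ⟨k, hμ⟩ := hμ
  have hk : k ^ 2 < 1 := by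
    obtain ⟨x⟩ := ‹Nonempty S₁›
    obtain ⟨l, hl, hb⟩ := μ.bound
    have h1 := hb _ (chart_mem_atlas ℂ x) _ (mem_chart_target ℂ x)
    have h2 := hμ _ (chart_mem_atlas ℂ x) _ (mem_chart_target ℂ x)
    have h3 := norm_nonneg (μ.coeff (chartAt ℂ x) (chartAt ℂ x x))
    nlinarith
  refine ⟨f.contMDiff, fun K F hK hF h0 hoff => ?_⟩
  obtain ⟨hfin, d, hd⟩ := harmonicEnergyOn_family σ μ ρ hμ hk hF hK
  refine ⟨hfin, ?_⟩
  -- The derivative `d` is known to exist, so a local minimum at `0` forces `d = 0`.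
  suffices hmin : ∀ᶠ t in 𝓝 (0 : ℝ), harmonicEnergyOn (gMetric σ μ) ρ K (F 0) ≤
      harmonicEnergyOn (gMetric σ μ) ρ K (F t) by
    have hloc : IsLocalMin (fun t => (harmonicEnergyOn (gMetric σ μ) ρ K (F t)).toReal) 0 := by
      filter_upwards [hmin] with t ht using ENNReal.toReal_mono (hfin t) ht
    rwa [hloc.hasDerivAt_eq_zero hd] at hd
  let _ : MeasurableSpace S₂ := borel S₂
  have : BorelSpace S₂ := ⟨rfl⟩
  have hKm := hK.isClosed.measurableSet
  -- Both sides are the `ρ`-area of the image of `K`, and `g '' K = f '' K` because the bijections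
  -- agree on the complement.
  have harea : ∀ g : Diffeo S₁ S₂, (∀ x ∉ K, g x = f x) →
      ∫⁻ x in K, ENNReal.ofReal (jacDensity σ ρ g x) ∂σ.toRMetric.area =
        ∫⁻ x in K, ENNReal.ofReal (jacDensity σ ρ f x) ∂σ.toRMetric.area := by
    intro g hg
    have h1 : ∫⁻ x in K, ENNReal.ofReal (jacDensity σ ρ g x) ∂σ.toRMetric.area =
        ρ.toRMetric.area (g '' K) :=
      setLIntegral_jacDensity σ ρ g.toHomeomorph g.contMDiff hKm
    have h2 : ∫⁻ x in K, ENNReal.ofReal (jacDensity σ ρ f x) ∂σ.toRMetric.area =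
        ρ.toRMetric.area (f '' K) :=
      setLIntegral_jacDensity σ ρ f.toHomeomorph f.contMDiff hKm
    have h3 : g '' Kᶜ = f '' Kᶜ := Set.image_congr hg
    rw [Set.image_compl_eq (f := g) g.bijective, Set.image_compl_eq (f := f) f.bijective, compl_inj_iff] at h3
    rw [h1, h2, h3]
  have hlbs : ∀ g ∈ 𝒜, (∀ x ∉ K, g x = f x) → lbsEnergyOn σ ρ μ K f ≤ lbsEnergyOn σ ρ μ K g :=
    fun g hg hgf => lbsEnergyOn_le_of_eq_off σ μ ρ hK hgf hf.finite (hf.minimal g hg)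
  have hdiff := eventually_exists_diffeo σ ρ f hK hF h0 hoff
  have hmem := h𝒜 K F hK hF h0 hoff
  rw [h0]
  rcases f.orientation σ ρ with hor | hor
  · have horF := eventually_norm_dz_dzbar_of_forall σ ρ (P := fun u v => v < u)
      (isOpen_lt continuous_snd continuous_fst) (fun r u v hr => mul_lt_mul_iff_right₀ hr)
      hK hF h0 hoff hor
    filter_upwards [hdiff, hmem, horF] with t ⟨g, hg⟩ hm ho
    have hgf : ∀ x ∉ K, g x = f x := fun x hx => by rw [hg]; exact hoff t x hx
    rw [← hg] at ho ⊢
    rw [harmonicEnergyOn_of_orientation_preserving σ μ ρ hμ hk K f.contMDiff hor,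
      harmonicEnergyOn_of_orientation_preserving σ μ ρ hμ hk K g.contMDiff ho, harea g hgf]
    gcongr
    exact hlbs g (hm g hg) hgf
  · have horF := eventually_norm_dz_dzbar_of_forall σ ρ (P := fun u v => u < v)
      (isOpen_lt continuous_fst continuous_snd) (fun r u v hr => mul_lt_mul_iff_right₀ hr)
      hK hF h0 hoff hor
    have hf1 := harmonicEnergyOn_of_orientation_reversing σ μ ρ hμ hk K f.contMDiff hor
    -- The area must be finite to be cancelled; it is dominated by a multiple of the finite Beltrami
    -- energy.
    have hAfin : ∫⁻ x in K, ENNReal.ofReal (jacDensity σ ρ f x) ∂σ.toRMetric.area ≠ ⊤ := by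
      have hL : lbsEnergyOn σ ρ μ K f ≠ ⊤ :=
        ne_top_of_le_ne_top hf.finite (setLIntegral_le_lintegral _ _)
      exact ne_top_of_le_ne_top (hf1 ▸ ENNReal.mul_ne_top ENNReal.ofReal_ne_top hL) le_add_self
    filter_upwards [hdiff, hmem, horF] with t ⟨g, hg⟩ hm ho
    have hgf : ∀ x ∉ K, g x = f x := fun x hx => by rw [hg]; exact hoff t x hx
    rw [← hg] at ho ⊢
    have hg1 := harmonicEnergyOn_of_orientation_reversing σ μ ρ hμ hk K g.contMDiff ho
    rw [harea g hgf] at hg1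
    refine (ENNReal.add_le_add_iff_right hAfin).1 ?_
    rw [hf1, hg1]
    gcongr
    exact hlbs g (hm g hg) hgf

end

end Surface

theorem lemma3p2
    {S₁ : Type*} [TopologicalSpace S₁] [T2Space S₁] [SecondCountableTopology S₁]
    [ConnectedSpace S₁] [ChartedSpace ℂ S₁] [IsManifold 𝓘(ℂ) ω S₁]
    [MeasurableSpace S₁] [BorelSpace S₁]
    {S₂ : Type*} [TopologicalSpace S₂] [T2Space S₂] [SecondCountableTopology S₂]
    [ConnectedSpace S₂] [ChartedSpace ℂ S₂] [IsManifold 𝓘(ℂ) ω S₂]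
    {S₁' : Type*} [TopologicalSpace S₁'] [T2Space S₁']
    {S₂' : Type*} [TopologicalSpace S₂'] [T2Space S₂']
    (j₁ : S₁ → S₁') (hj₁ : Topology.IsOpenEmbedding j₁)
    (j₂ : S₂ → S₂') (hj₂ : Topology.IsOpenEmbedding j₂) (h : S₁' → S₂')
    (σ : Surface.ConformalMetric S₁) (ρ : Surface.ConformalMetric S₂)
    (μ : Surface.BeltramiDifferential S₁) (hμ : μ.HasConstantModulus)
    (f : Surface.Diffeo S₁ S₂)
    (hf : Surface.IsLBS σ ρ μ (Surface.boundaryClass j₁ j₂ h) f ∨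
      Surface.IsLBS σ ρ μ (Surface.boundaryClass j₁ j₂ h ∩ {g | Surface.IsQuasiconformal g}) f) :
    Surface.IsHarmonicMap (Surface.gMetric σ μ) ρ f := by
  rcases hf with hf | hf
  · refine hf.isHarmonicMap hμ fun K F hK _ _ hoff => Filter.Eventually.of_forall fun t g hg => ?_
    exact Surface.mem_boundaryClass_of_eqOn_compl hj₁.continuous hf.mem hK
      fun x hx => by rw [hg]; exact hoff t x hx
  · refine hf.isHarmonicMap hμ fun K F hK hF h0 hoff => ?_
    -- Boundary values persist for every `t`; only quasi-conformality restricts to small times.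
    filter_upwards [hf.mem.2.eventually σ ρ hK hF h0 hoff] with t ht g hg
    refine ⟨Surface.mem_boundaryClass_of_eqOn_compl hj₁.continuous hf.mem.1 hK
      fun x hx => by rw [hg]; exact hoff t x hx, ?_⟩
    rw [Set.mem_ofPred_eq, hg]
    exact ht
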